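/- **Generalization of Campbell's theorem.** For a measurable space $\Omega$ let $\mathcal M(\Omega)$ be the set of finite measures and $\mathcal S(\Omega)$ the space of finite signed measures with the total variation norm, so that $\|\mu\|=\mu(\Omega)$ for $\mu\in\mathcal M(\Omega)$. Let $\mathcal S^{1/2}(\Omega)$ be the Banach space of square roots of signed measures, i.e. the direct limit, over $\mu\in\mathcal M(\Omega)$ directed by absolute continuity, of the spaces $\mathcal S^{1/2}(\Omega;\mu)=\{\phi\,\mu^{1/2}:\phi\in L^2(\mu)\}$ with norm $\|\phi\mu^{1/2}\|=\|\phi\|_{L^2(\mu)}$ and identifications $\phi\,\mu^{1/2}=\phi\,(d\mu/d\nu)^{1/2}\,\nu^{1/2}$ for $\mu\ll\nu$. Put $\mathcal M^{1/2}(\Omega)=\{\mu^{1/2}:\mu\in\mathcal M(\Omega)\}$, with tangent cones $T_{\mu^{1/2}}\mathcal M^{1/2}(\Omega)=\mathcal S^{1/2}(\Omega;\mu)$. A vector field on $\mathcal M^{1/2}(\Omega)$ is a continuous map $X:\mathcal M^{1/2}(\Omega)\to\mathcal S^{1/2}(\Omega)$ with $X_{\mu^{1/2}}\in T_{\mu^{1/2}}\mathcal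 M^{1/2}(\Omega)$; a $2$-tensor on $\mathcal M^{1/2}(\Omega)$ is a collection of bilinear forms $\Psi_{\mu^{1/2}}$ on the tangent cones such that $\mu^{1/2}\mapsto\Psi_{\mu^{1/2}}(X_{\mu^{1/2}},Y_{\mu^{1/2}})$ is continuous for all vector fields $X,Y$. At $\mu^{1/2}$ set $$\mathfrak g_F(\phi\mu^{1/2},\psi\mu^{1/2})=4\int_\Omega\phi\psi\,d\mu,\qquad \tau^1(\phi\mu^{1/2})=2\int_\Omega\phi\,d\mu .$$ A Markov kernel $K:\Omega\to\mathcal P(\Omega')$ is congruent if there is a measurable $\kappa:\Omega'\to\Omega$ with $\kappa_*K(\omega)=\delta_\omega$ for all $\omega$. It acts on $T_{\mu^{1/2}}\mathcal M^{1/2}(\Omega)$ by the formal derivative $$dK(\phi\mu^{1/2})=\frac{d\{K_*(\phi\mu)\}}{d\{K_*\mu\}}\,(K_*\mu)^{1/2},\qquad K_*\sigma(A')=\int_\Omega K(\omega;A')\,d\sigma(\omega).$$ A collection $(\Theta_\Omega)$ of $2$-tensors on $\mathcal M^{1/2}(\Omega)$, one for each measurable space $\Omega$, is a congruent family if $(\Theta_{\Omega'})_{(K_*\mu)^{1/2}}(dK(V_1),dK(V_2))=(\Theta_\Omega)_{\mu^{1/2}}(V_1,V_2)$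 for all congruent Markov kernels $K:\Omega\to\mathcal P(\Omega')$, all $\mu\in\mathcal M(\Omega)$ and all $V_1,V_2\in T_{\mu^{1/2}}\mathcal M^{1/2}(\Omega)$. **Statement.** Let $(\Theta_\Omega)$ be a congruent family of $2$-tensors on $\mathcal M^{1/2}(\Omega)$. Then there are continuous functions $a,b:(0,\infty)\to\mathbb R$ such that for all $\Omega$, all $\mu\in\mathcal M(\Omega)$ and all $V_1,V_2\in T_{\mu^{1/2}}\mathcal M^{1/2}(\Omega)$ $$(\Theta_\Omega)_{\mu^{1/2}}(V_1,V_2)=a(\|\mu\|)\,\mathfrak g_F(V_1,V_2)+b(\|\mu\|)\,\tau^1(V_1)\,\tau^1(V_2).$$ Moreover, with the same $a,b$: let $M$ be a (finite- or infinite-dimensional, boundaryless) $C^1$ manifold modelled on a real normed space and $\mathbf p:M\to\mathcal M(\Omega)$ a $2$-integrable parametrized measure model, i.e. $\mathbf p$ is Fréchet differentiable as a map into $\mathcal S(\Omega)$ and $\mathbf p^{1/2}:M\to\mathcal S^{1/2}(\Omega)$ is continuously Fréchet differentiable. Let $\partial_V\log\mathbf p(\xi)=d\{d_\xi\mathbf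 p(V)\}/d\{\mathbf p(\xi)\}$ be the logarithmic derivative. Then for all $\xi\in M$ and $V_1,V_2\in T_\xi M$ the vectors $d_\xi\mathbf p^{1/2}(V_i)$ lie in $T_{\mathbf p(\xi)^{1/2}}\mathcal M^{1/2}(\Omega)$, the function $\partial_{V_1}\log\mathbf p(\xi)\,\partial_{V_2}\log\mathbf p(\xi)$ is $\mathbf p(\xi)$-integrable, $\|\mathbf p\|$ is differentiable at $\xi$, and $$(\Theta_\Omega)_{\mathbf p(\xi)^{1/2}}\big(d_\xi\mathbf p^{1/2}(V_1),d_\xi\mathbf p^{1/2}(V_2)\big)=a(\|\mathbf p(\xi)\|)\int_\Omega\partial_{V_1}\log\mathbf p(\xi)\,\partial_{V_2}\log\mathbf p(\xi)\,d\mathbf p(\xi)+b(\|\mathbf p(\xi)\|)\,\big(\partial_{V_1}\|\mathbf p(\xi)\|\big)\big(\partial_{V_2}\|\mathbf p(\xi)\|\big).$$ (At the zero measure all tensors involved vanish, and the right-hand sides are read as $0$.) -/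

import Mathlib

open MeasureTheory ProbabilityTheory Set
open scoped Manifold ENNReal

universe u v w

/-! ### Signed measures with the total variation norm -/

namespace MeasureTheory.SignedMeasure

variable {Ω : Type u} [MeasurableSpace Ω]

/-- Total variation norm of a signed measure. -/
noncomputable instance instNormTV : Norm (SignedMeasure Ω) where
  norm σ := (σ.totalVariation univ).toReal

theorem norm_def (σ : SignedMeasure Ω) : ‖σ‖ = (σ.totalVariation univ).toReal := rfl

theorem totalVariation_univ_ne_top (σ : SignedMeasure Ω) : σ.totalVariation univ ≠ ∞ := by
  simp [totalVariation]

theorem normCore : NormedSpace.Core ℝ (SignedMeasure Ω) where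
  norm_nonneg σ := ENNReal.toReal_nonneg
  norm_smul c σ := by
    simp [norm_def, totalVariation_eq_variation, VectorMeasure.variation_smul]
  norm_triangle σ τ := by
    rw [norm_def, norm_def, norm_def, ← ENNReal.toReal_add (totalVariation_univ_ne_top σ)
      (totalVariation_univ_ne_top τ)]
    refine ENNReal.toReal_mono (ENNReal.add_ne_top.2 ⟨totalVariation_univ_ne_top σ,
      totalVariation_univ_ne_top τ⟩) ?_
    simp only [totalVariation_eq_variation]
    exact VectorMeasure.variation_add_le univ
  norm_eq_zero_iff σ := by
    rw [norm_def, ENNReal.toReal_eq_zero_iff]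
    simp [totalVariation_univ_ne_top σ]
    rw [totalVariation_eq_variation, VectorMeasure.variation_eq_zero]

noncomputable instance instNormedAddCommGroupTV : NormedAddCommGroup (SignedMeasure Ω) :=
  NormedAddCommGroup.ofCore normCore

noncomputable instance instNormedSpaceTV : NormedSpace ℝ (SignedMeasure Ω) :=
  NormedSpace.ofCore normCore

end MeasureTheory.SignedMeasure

namespace InfoGeom

/-! ### The space `𝒮^{1/2}(Ω)` of square roots of signed measures -/

section HalfDensity

variable {Ω : Type u} [MeasurableSpace Ω]

/-- Finite measures on `Ω`, preordered by absolute continuity. -/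
structure DomMeasure (Ω : Type u) [MeasurableSpace Ω] where
  meas : FiniteMeasure Ω

instance : Preorder (DomMeasure Ω) where
  le μ ν := (μ.meas : Measure Ω) ≪ (ν.meas : Measure Ω)
  le_refl _ := Measure.AbsolutelyContinuous.rfl
  le_trans _ _ _ h h' := h.trans h'

instance : Nonempty (DomMeasure Ω) := ⟨⟨0⟩⟩

instance : IsDirectedOrder (DomMeasure Ω) where
  directed μ ν := by
    refine ⟨⟨μ.meas + ν.meas⟩, ?_, ?_⟩
    · change (μ.meas : Measure Ω) ≪ ((μ.meas + ν.meas : FiniteMeasure Ω) : Measure Ω)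
      rw [FiniteMeasure.toMeasure_add]
      exact (Measure.AbsolutelyContinuous.rfl).add_right _
    · change (ν.meas : Measure Ω) ≪ ((μ.meas + ν.meas : FiniteMeasure Ω) : Measure Ω)
      rw [FiniteMeasure.toMeasure_add, add_comm]
      exact (Measure.AbsolutelyContinuous.rfl).add_right _

/-- The function `(dμ/dν)^{1/2}`. -/
noncomputable def rootDeriv (μ ν : Measure Ω) (ω : Ω) : ℝ := √(μ.rnDeriv ν ω).toReal

theorem measurable_rootDeriv (μ ν : Measure Ω) : Measurable (rootDeriv μ ν) :=
  (Measure.measurable_rnDeriv μ ν).ennreal_toReal.sqrt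

theorem ae_imp_of_ac {μ ν : Measure Ω} [IsFiniteMeasure μ] [IsFiniteMeasure ν] (h : μ ≪ ν)
    {P : Ω → Prop} (hP : ∀ᵐ ω ∂μ, P ω) : ∀ᵐ ω ∂ν, μ.rnDeriv ν ω ≠ 0 → P ω := by
  rw [← Measure.withDensity_rnDeriv_eq μ ν h] at hP
  exact (ae_withDensity_iff (Measure.measurable_rnDeriv μ ν)).1 hP

theorem rootDeriv_eq_zero {μ ν : Measure Ω} {ω : Ω} (h : μ.rnDeriv ν ω = 0) :
    rootDeriv μ ν ω = 0 := by simp [rootDeriv, h]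

theorem ae_mul_rootDeriv_congr {μ ν : Measure Ω} [IsFiniteMeasure μ] [IsFiniteMeasure ν]
    (h : μ ≪ ν) {f g : Ω → ℝ} (hfg : f =ᵐ[μ] g) :
    (fun ω => f ω * rootDeriv μ ν ω) =ᵐ[ν] fun ω => g ω * rootDeriv μ ν ω := by
  filter_upwards [ae_imp_of_ac h hfg] with ω hω
  by_cases h0 : μ.rnDeriv ν ω = 0
  · simp [rootDeriv_eq_zero h0]
  · rw [hω h0]

theorem eLpNorm_mul_rootDeriv {μ ν : Measure Ω} [IsFiniteMeasure μ] [IsFiniteMeasure ν]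
    (h : μ ≪ ν) {f : Ω → ℝ} (hf : StronglyMeasurable f) :
    eLpNorm (fun ω => f ω * rootDeriv μ ν ω) 2 ν = eLpNorm f 2 μ := by
  rw [eLpNorm_eq_lintegral_rpow_enorm_toReal two_ne_zero ENNReal.ofNat_ne_top,
    eLpNorm_eq_lintegral_rpow_enorm_toReal two_ne_zero ENNReal.ofNat_ne_top,
    ← lintegral_rnDeriv_mul h (by fun_prop)]
  congr 1
  refine lintegral_congr_ae ?_
  filter_upwards [Measure.rnDeriv_ne_top μ ν] with ω hω
  have : ‖rootDeriv μ ν ω‖ₑ ^ (2 : ℝ) = μ.rnDeriv ν ω := by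
    rw [rootDeriv, Real.enorm_of_nonneg (Real.sqrt_nonneg _),
      ENNReal.ofReal_rpow_of_nonneg (Real.sqrt_nonneg _) (by norm_num)]
    rw [Real.rpow_two, Real.sq_sqrt ENNReal.toReal_nonneg, ENNReal.ofReal_toReal hω]
  simp only [ENNReal.toReal_ofNat]
  rw [enorm_mul, ENNReal.mul_rpow_of_nonneg _ _ (by norm_num), this, mul_comm]

theorem memLp_mul_rootDeriv {μ ν : Measure Ω} [IsFiniteMeasure μ] [IsFiniteMeasure ν]
    (h : μ ≪ ν) (φ : Lp ℝ 2 μ) : MemLp (fun ω => φ ω * rootDeriv μ ν ω) 2 ν := by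
  refine ⟨((Lp.stronglyMeasurable φ).measurable.mul
    (measurable_rootDeriv μ ν)).aestronglyMeasurable, ?_⟩
  rw [eLpNorm_mul_rootDeriv h (Lp.stronglyMeasurable φ)]
  exact Lp.eLpNorm_lt_top φ

/-- For `μ ≪ ν`, the isometric inclusion `L²(μ) → L²(ν)`, `φ ↦ φ (dμ/dν)^{1/2}`, which expresses
`φ μ^{1/2} = φ (dμ/dν)^{1/2} ν^{1/2}`. -/
noncomputable def changeBase (μ ν : DomMeasure Ω) (h : μ ≤ ν) :
    Lp ℝ 2 (μ.meas : Measure Ω) →ₗᵢ[ℝ] Lp ℝ 2 (ν.meas : Measure Ω) where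
  toFun φ := (memLp_mul_rootDeriv h φ).toLp _
  map_add' φ ψ := by
    rw [← MemLp.toLp_add (memLp_mul_rootDeriv h φ) (memLp_mul_rootDeriv h ψ), MemLp.toLp_eq_toLp_iff]
    refine (ae_mul_rootDeriv_congr h (Lp.coeFn_add φ ψ)).trans (.of_forall fun ω => ?_)
    simp [add_mul]
  map_smul' c φ := by
    rw [RingHom.id_apply, ← MemLp.toLp_const_smul c (memLp_mul_rootDeriv h φ), MemLp.toLp_eq_toLp_iff]
    refine (ae_mul_rootDeriv_congr h (Lp.coeFn_smul c φ)).trans (.of_forall fun ω => ?_)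
    simp [mul_assoc]
  norm_map' φ := by
    change ‖(memLp_mul_rootDeriv h φ).toLp _‖ = ‖φ‖
    rw [Lp.norm_toLp, eLpNorm_mul_rootDeriv h (Lp.stronglyMeasurable φ), Lp.norm_def]

theorem coeFn_changeBase {μ ν : DomMeasure Ω} (h : μ ≤ ν) (φ : Lp ℝ 2 (μ.meas : Measure Ω)) :
    changeBase μ ν h φ =ᵐ[(ν.meas : Measure Ω)]
      fun ω => φ ω * rootDeriv (μ.meas : Measure Ω) (ν.meas : Measure Ω) ω :=
  MemLp.coeFn_toLp (memLp_mul_rootDeriv h φ)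

instance : DirectedSystem (fun μ : DomMeasure Ω => Lp ℝ 2 (μ.meas : Measure Ω))
    (fun μ ν h => changeBase μ ν h) where
  map_self μ φ := by
    apply Lp.ext
    refine (coeFn_changeBase le_rfl φ).trans ?_
    filter_upwards [Measure.rnDeriv_self (μ.meas : Measure Ω)] with ω hω
    simp [rootDeriv, hω]
  map_map κ ν μ hμν hνκ φ := by
    apply Lp.ext
    refine (coeFn_changeBase _ _).trans ?_
    refine (ae_mul_rootDeriv_congr hνκ (coeFn_changeBase hμν φ)).trans ?_
    refine .trans ?_ (coeFn_changeBase (hμν.trans hνκ) φ).symm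
    filter_upwards [Measure.rnDeriv_mul_rnDeriv (κ := (κ.meas : Measure Ω)) hμν] with ω hω
    rw [Pi.mul_apply] at hω
    rw [rootDeriv, rootDeriv, rootDeriv, ← hω, ENNReal.toReal_mul,
      Real.sqrt_mul ENNReal.toReal_nonneg, mul_assoc]

/-- The space `𝒮^{1/2}(Ω)`: the direct limit, over all finite measures `μ` directed by absolute
continuity, of the spaces `𝒮^{1/2}(Ω; μ) = {φ μ^{1/2} | φ ∈ L²(μ)}`. -/
def HalfDensity (Ω : Type u) [MeasurableSpace Ω] : Type u :=
  DirectLimit (fun μ : DomMeasure Ω => Lp ℝ 2 (μ.meas : Measure Ω)) changeBase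

namespace HalfDensity

noncomputable instance : AddCommGroup (HalfDensity Ω) :=
  inferInstanceAs (AddCommGroup
    (DirectLimit (fun μ : DomMeasure Ω => Lp ℝ 2 (μ.meas : Measure Ω)) changeBase))

noncomputable instance : Module ℝ (HalfDensity Ω) :=
  inferInstanceAs (Module ℝ
    (DirectLimit (fun μ : DomMeasure Ω => Lp ℝ 2 (μ.meas : Measure Ω)) changeBase))

/-- `φ ↦ φ μ^{1/2}` as a linear map `L²(μ) → 𝒮^{1/2}(Ω)`. -/
noncomputable def ofLinear (μ : FiniteMeasure Ω) : Lp ℝ 2 (μ : Measure Ω) →ₗ[ℝ] HalfDensity Ω :=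
  DirectLimit.Module.of ℝ (DomMeasure Ω) (fun μ : DomMeasure Ω => Lp ℝ 2 (μ.meas : Measure Ω))
    changeBase ⟨μ⟩

theorem exists_ofLinear (x : HalfDensity Ω) : ∃ μ φ, x = ofLinear μ φ := by
  obtain ⟨μ, φ, h⟩ := DirectLimit.exists_eq_mk changeBase x
  exact ⟨μ.meas, φ, h⟩

theorem exists_ofLinear₂ (x y : HalfDensity Ω) :
    ∃ μ φ ψ, x = ofLinear μ φ ∧ y = ofLinear μ ψ := by
  obtain ⟨μ, φ, ψ, h, h'⟩ := DirectLimit.exists_eq_mk₂ changeBase x y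
  exact ⟨μ.meas, φ, ψ, h, h'⟩

/-- The norm of `𝒮^{1/2}(Ω)`, given by `‖φ μ^{1/2}‖ = ‖φ‖_{L²(μ)}`. -/
noncomputable instance instNorm : Norm (HalfDensity Ω) where
  norm := DirectLimit.lift changeBase (fun _ φ => ‖φ‖)
    (fun μ ν h φ => ((changeBase μ ν h).norm_map φ).symm)

theorem norm_ofLinear (μ : FiniteMeasure Ω) (φ : Lp ℝ 2 (μ : Measure Ω)) :
    ‖ofLinear μ φ‖ = ‖φ‖ := rfl

theorem normCore : NormedSpace.Core ℝ (HalfDensity Ω) where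
  norm_nonneg x := by
    obtain ⟨μ, φ, rfl⟩ := exists_ofLinear x
    rw [norm_ofLinear]
    exact norm_nonneg φ
  norm_smul c x := by
    obtain ⟨μ, φ, rfl⟩ := exists_ofLinear x
    rw [← map_smul, norm_ofLinear, norm_ofLinear, norm_smul]
  norm_triangle x y := by
    obtain ⟨μ, φ, ψ, rfl, rfl⟩ := exists_ofLinear₂ x y
    rw [← map_add]
    simp only [norm_ofLinear]
    exact norm_add_le φ ψ
  norm_eq_zero_iff x := by
    obtain ⟨μ, φ, rfl⟩ := exists_ofLinear x
    rw [norm_ofLinear, norm_eq_zero]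
    refine ⟨fun h => by rw [h, map_zero], fun h => ?_⟩
    rw [← norm_eq_zero, ← norm_ofLinear μ φ, h, ← map_zero (ofLinear μ), norm_ofLinear, norm_zero]

noncomputable instance : NormedAddCommGroup (HalfDensity Ω) := NormedAddCommGroup.ofCore normCore

noncomputable instance : NormedSpace ℝ (HalfDensity Ω) := NormedSpace.ofCore normCore

/-- `φ ↦ φ μ^{1/2}` as a linear isometry `L²(μ) → 𝒮^{1/2}(Ω)`. -/
noncomputable def of (μ : FiniteMeasure Ω) : Lp ℝ 2 (μ : Measure Ω) →ₗᵢ[ℝ] HalfDensity Ω where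
  toLinearMap := ofLinear μ
  norm_map' := norm_ofLinear μ

end HalfDensity

/-- The square root `μ^{1/2} = 1 · μ^{1/2}` of a finite measure. The set `ℳ^{1/2}(Ω)` consists of
these elements, and we label its points `μ^{1/2}` by the measures `μ`. -/
noncomputable def sqrtMeasure (μ : FiniteMeasure Ω) : HalfDensity Ω :=
  HalfDensity.of μ (Lp.const 2 (μ : Measure Ω) (1 : ℝ))

/-- Labelling the points of `ℳ^{1/2}(Ω)` by `μ` loses nothing. -/
theorem sqrtMeasure_injective : Function.Injective (sqrtMeasure (Ω := Ω)) := by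
  intro μ ν h
  have key : ∀ (μ κ : DomMeasure Ω) (hl : μ ≤ κ),
      changeBase μ κ hl (Lp.const 2 (μ.meas : Measure Ω) (1 : ℝ)) =ᵐ[(κ.meas : Measure Ω)]
        rootDeriv (μ.meas : Measure Ω) (κ.meas : Measure Ω) := by
    intro μ κ hl
    refine (coeFn_changeBase hl _).trans ?_
    refine (ae_mul_rootDeriv_congr hl (Lp.coeFn_const ..)).trans (.of_forall fun ω => ?_)
    simp
  obtain ⟨κ, h1, h2⟩ := exists_ge_ge (⟨μ⟩ : DomMeasure Ω) ⟨ν⟩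
  have e1 := DirectLimit.Module.of_f (R := ℝ) (f := changeBase) (hij := h1)
    (x := Lp.const 2 (μ : Measure Ω) (1 : ℝ))
  have e2 := DirectLimit.Module.of_f (R := ℝ) (f := changeBase) (hij := h2)
    (x := Lp.const 2 (ν : Measure Ω) (1 : ℝ))
  have e3 : HalfDensity.of κ.meas (changeBase _ κ h1 (Lp.const 2 (μ : Measure Ω) (1 : ℝ)))
      = HalfDensity.of κ.meas (changeBase _ κ h2 (Lp.const 2 (ν : Measure Ω) (1 : ℝ))) :=
    e1.trans (h.trans e2.symm)
  have e4 := (HalfDensity.of κ.meas).injective e3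
  have e5 : rootDeriv (μ : Measure Ω) (κ.meas : Measure Ω) =ᵐ[(κ.meas : Measure Ω)]
      rootDeriv (ν : Measure Ω) (κ.meas : Measure Ω) := by
    refine (key ⟨μ⟩ κ h1).symm.trans (.trans ?_ (key ⟨ν⟩ κ h2))
    rw [e4]
  have e6 : (μ : Measure Ω).rnDeriv (κ.meas : Measure Ω) =ᵐ[(κ.meas : Measure Ω)]
      (ν : Measure Ω).rnDeriv (κ.meas : Measure Ω) := by
    filter_upwards [e5, Measure.rnDeriv_ne_top (μ : Measure Ω) (κ.meas : Measure Ω),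
      Measure.rnDeriv_ne_top (ν : Measure Ω) (κ.meas : Measure Ω)] with ω h h3 h4
    rw [rootDeriv, rootDeriv, Real.sqrt_inj ENNReal.toReal_nonneg ENNReal.toReal_nonneg] at h
    exact (ENNReal.toReal_eq_toReal_iff' h3 h4).1 h
  apply Subtype.ext
  change (μ : Measure Ω) = (ν : Measure Ω)
  rw [← Measure.withDensity_rnDeriv_eq _ _ h1, ← Measure.withDensity_rnDeriv_eq _ _ h2]
  exact withDensity_congr_ae e6

end HalfDensity

/-! ### Vector fields and `2`-tensor fields on `ℳ^{1/2}(Ω)` -/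

section Tensor

variable {Ω : Type u} [MeasurableSpace Ω]

/-- The tangent cone `T_{μ^{1/2}} ℳ^{1/2}(Ω) = 𝒮^{1/2}(Ω; μ) = {φ μ^{1/2} | φ ∈ L²(μ)}`. -/
noncomputable def tangent (μ : FiniteMeasure Ω) : Submodule ℝ (HalfDensity Ω) :=
  LinearMap.range (HalfDensity.of μ).toLinearMap

/-- The isomorphism `L²(μ) ≃ 𝒮^{1/2}(Ω; μ)`, `φ ↦ φ μ^{1/2}`. -/
noncomputable def tangentEquiv (μ : FiniteMeasure Ω) : Lp ℝ 2 (μ : Measure Ω) ≃ₗ[ℝ] tangent μ :=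
  LinearEquiv.ofInjective (HalfDensity.of μ).toLinearMap (HalfDensity.of μ).injective

/-- The function `φ` of a tangent vector `φ μ^{1/2}`. -/
noncomputable def density {μ : FiniteMeasure Ω} (V : tangent μ) : Lp ℝ 2 (μ : Measure Ω) :=
  (tangentEquiv μ).symm V

/-- Continuity, in the topology of `𝒮^{1/2}(Ω)`, of a map defined on `ℳ^{1/2}(Ω)`, that is, of
`μ^{1/2} ↦ F μ`. -/
def ContinuousOnSqrt {Y : Type*} [TopologicalSpace Y] (F : FiniteMeasure Ω → Y) : Prop :=
  @Continuous _ _ (TopologicalSpace.induced sqrtMeasure inferInstance) _ F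

/-- A vector field on `ℳ^{1/2}(Ω)`: a continuous map `X : ℳ^{1/2}(Ω) → 𝒮^{1/2}(Ω)` such that
`X μ` is tangent at `μ^{1/2}`. -/
structure VectorField (Ω : Type u) [MeasurableSpace Ω] where
  toFun : ∀ μ : FiniteMeasure Ω, tangent μ
  continuous_toFun : ContinuousOnSqrt fun μ => (toFun μ : HalfDensity Ω)

/-- A covariant `2`-tensor field on `ℳ^{1/2}(Ω)`: bilinear forms on the tangent cones whose values
on continuous vector fields are continuous. -/
structure TwoTensorField (Ω : Type u) [MeasurableSpace Ω] where
  form : ∀ μ : FiniteMeasure Ω, LinearMap.BilinForm ℝ (tangent μ)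
  continuous_form : ∀ X Y : VectorField Ω,
    ContinuousOnSqrt fun μ => form μ (X.toFun μ) (Y.toFun μ)

/-- The Fisher metric, i.e. the canonical `2`-tensor `L²_Ω(ν₁, ν₂) = 2² ∫ d(ν₁ · ν₂)`, at
`μ^{1/2}`. -/
noncomputable def fisher (μ : FiniteMeasure Ω) (V W : tangent μ) : ℝ :=
  2 ^ 2 * ∫ ω, density V ω * density W ω ∂(μ : Measure Ω)

/-- The canonical `1`-tensor `τ¹_{Ω;1/2}(ν) = 2 ∫ d(ν · μ^{1/2})` at `μ^{1/2}`. -/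
noncomputable def tauOne (μ : FiniteMeasure Ω) (V : tangent μ) : ℝ :=
  2 * ∫ ω, density V ω ∂(μ : Measure Ω)

end Tensor

/-! ### Markov kernels and congruent families -/

section Markov

variable {Ω Ω' : Type u} [MeasurableSpace Ω] [MeasurableSpace Ω']

/-- The Markov kernel `K` is congruent: there is a statistic `κ : Ω' → Ω` with
`κ_* K(ω) = δ_ω` for all `ω`. -/
def IsCongruent (K : Kernel Ω Ω') : Prop :=
  ∃ κ : Ω' → Ω, Measurable κ ∧ ∀ ω, (K ω).map κ = Measure.dirac ω

/-- `K_* μ = ∫ K(ω; ·) dμ(ω)` for a finite measure `μ`. -/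
noncomputable def push (K : Kernel Ω Ω') [IsMarkovKernel K] (μ : FiniteMeasure Ω) :
    FiniteMeasure Ω' :=
  ⟨K ∘ₘ (μ : Measure Ω), inferInstance⟩

/-- The signed measure `K_*(φ μ)`, `A' ↦ ∫ K(ω; A') φ(ω) dμ(ω)`, has a density in `L²(K_* μ)`. -/
theorem exists_pushDensity (K : Kernel Ω Ω') [IsMarkovKernel K] (μ : FiniteMeasure Ω)
    (φ : Lp ℝ 2 (μ : Measure Ω)) :
    ∃ φ' : Lp ℝ 2 (push K μ : Measure Ω'), ∀ A' : Set Ω', MeasurableSet A' →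
      ∫ ω' in A', φ' ω' ∂(push K μ : Measure Ω') =
        ∫ ω, (K ω).real A' * φ ω ∂(μ : Measure Ω) := by
  set ρ : Measure (Ω × Ω') := (μ : Measure Ω) ⊗ₘ K with hρ
  have hfst : MeasurePreserving Prod.fst ρ (μ : Measure Ω) :=
    ⟨measurable_fst, Measure.fst_compProd (μ : Measure Ω) K⟩
  have hsnd : MeasurePreserving Prod.snd ρ (push K μ : Measure Ω') :=
    ⟨measurable_snd, Measure.snd_compProd (μ : Measure Ω) K⟩
  set f : Ω × Ω' → ℝ := fun x => φ x.1 with hf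
  have hfm : MemLp f 2 ρ := (Lp.memLp φ).comp_measurePreserving hfst
  have hfi : Integrable f ρ := hfm.integrable one_le_two
  have hmle : MeasurableSpace.comap (Prod.snd : Ω × Ω' → Ω') inferInstance ≤
      Prod.instMeasurableSpace := measurable_snd.comap_le
  obtain ⟨h, hmeas, hh⟩ :=
    (stronglyMeasurable_condExp (μ := ρ) (f := f) 
      (m := MeasurableSpace.comap (Prod.snd : Ω × Ω' → Ω') inferInstance)).measurable.exists_eq_measurable_comp
  have hhm : MemLp h 2 (push K μ : Measure Ω') := by
    have h1 : MemLp (h ∘ Prod.snd) 2 ρ := by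
      rw [← hh]
      exact hfm.condExp one_le_two
    rw [← hsnd.map_eq]
    exact (memLp_map_measure_iff hmeas.aestronglyMeasurable measurable_snd.aemeasurable).2 h1
  refine ⟨hhm.toLp h, fun A' hA' => ?_⟩
  have hS : MeasurableSet[MeasurableSpace.comap (Prod.snd : Ω × Ω' → Ω') inferInstance]
      (Prod.snd ⁻¹' A' : Set (Ω × Ω')) := ⟨A', hA', rfl⟩
  calc ∫ ω' in A', (hhm.toLp h) ω' ∂(push K μ : Measure Ω')
      = ∫ ω' in A', h ω' ∂(push K μ : Measure Ω') :=
        integral_congr_ae (ae_restrict_of_ae hhm.coeFn_toLp)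
    _ = ∫ x in Prod.snd ⁻¹' A', h x.2 ∂ρ := by
        rw [← hsnd.map_eq, setIntegral_map hA' hmeas.aestronglyMeasurable
          measurable_snd.aemeasurable]
    _ = ∫ x in Prod.snd ⁻¹' A', (condExp (MeasurableSpace.comap (Prod.snd : Ω × Ω' → Ω')
          inferInstance) ρ f) x ∂ρ := by
        rw [hh]; rfl
    _ = ∫ x in Prod.snd ⁻¹' A', f x ∂ρ :=
        setIntegral_condExp hmle hfi hS
    _ = ∫ x in univ ×ˢ A', f x ∂ρ := by rw [univ_prod]
    _ = ∫ ω, (K ω).real A' * φ ω ∂(μ : Measure Ω) := by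
        rw [Measure.setIntegral_compProd MeasurableSet.univ hA' hfi.integrableOn]
        simp [hf]

/-- The density `d{K_*(φ μ)} / d{K_* μ}`. -/
noncomputable def pushDensity (K : Kernel Ω Ω') [IsMarkovKernel K] (μ : FiniteMeasure Ω)
    (φ : Lp ℝ 2 (μ : Measure Ω)) : Lp ℝ 2 (push K μ : Measure Ω') :=
  (exists_pushDensity K μ φ).choose

theorem pushDensity_spec (K : Kernel Ω Ω') [IsMarkovKernel K] (μ : FiniteMeasure Ω)
    (φ : Lp ℝ 2 (μ : Measure Ω)) {A' : Set Ω'} (hA' : MeasurableSet A') :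
    ∫ ω' in A', pushDensity K μ φ ω' ∂(push K μ : Measure Ω') =
      ∫ ω, (K ω).real A' * φ ω ∂(μ : Measure Ω) :=
  (exists_pushDensity K μ φ).choose_spec A' hA'

theorem pushDensity_unique (K : Kernel Ω Ω') [IsMarkovKernel K] (μ : FiniteMeasure Ω)
    (φ : Lp ℝ 2 (μ : Measure Ω)) (ψ : Lp ℝ 2 (push K μ : Measure Ω'))
    (hψ : ∀ A' : Set Ω', MeasurableSet A' → ∫ ω' in A', ψ ω' ∂(push K μ : Measure Ω') =
      ∫ ω, (K ω).real A' * φ ω ∂(μ : Measure Ω)) :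
    pushDensity K μ φ = ψ := by
  apply Lp.ext
  refine Integrable.ae_eq_of_forall_setIntegral_eq _ _
    ((Lp.memLp (pushDensity K μ φ)).integrable one_le_two) ((Lp.memLp ψ).integrable one_le_two) ?_
  intro A' hA' _
  rw [pushDensity_spec K μ φ hA', hψ A' hA']

theorem integrable_real_mul (K : Kernel Ω Ω') [IsMarkovKernel K] (μ : FiniteMeasure Ω)
    (φ : Lp ℝ 2 (μ : Measure Ω)) {A' : Set Ω'} (hA' : MeasurableSet A') :
    Integrable (fun ω => (K ω).real A' * φ ω) (μ : Measure Ω) := by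
  refine ((Lp.memLp φ).integrable one_le_two).bdd_mul (c := 1)
    (K.measurable_coe hA').ennreal_toReal.aestronglyMeasurable (.of_forall fun ω => ?_)
  rw [Real.norm_of_nonneg measureReal_nonneg]
  exact measureReal_le_one

/-- `pushDensity` as a linear map. -/
noncomputable def pushDensityLinear (K : Kernel Ω Ω') [IsMarkovKernel K] (μ : FiniteMeasure Ω) :
    Lp ℝ 2 (μ : Measure Ω) →ₗ[ℝ] Lp ℝ 2 (push K μ : Measure Ω') where
  toFun := pushDensity K μ
  map_add' φ ψ := by
    refine pushDensity_unique K μ _ _ fun A' hA' => ?_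
    have h1 := ((Lp.memLp (pushDensity K μ φ)).integrable one_le_two).integrableOn (s := A')
    have h2 := ((Lp.memLp (pushDensity K μ ψ)).integrable one_le_two).integrableOn (s := A')
    rw [integral_congr_ae (ae_restrict_of_ae (Lp.coeFn_add _ _))]
    simp only [Pi.add_apply]
    rw [integral_add h1 h2, pushDensity_spec K μ φ hA', pushDensity_spec K μ ψ hA',
      ← integral_add (integrable_real_mul K μ φ hA') (integrable_real_mul K μ ψ hA')]
    refine integral_congr_ae ?_
    filter_upwards [Lp.coeFn_add φ ψ] with ω hω
    rw [hω, Pi.add_apply, mul_add]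
  map_smul' c φ := by
    refine pushDensity_unique K μ _ _ fun A' hA' => ?_
    rw [RingHom.id_apply, integral_congr_ae (ae_restrict_of_ae (Lp.coeFn_smul _ _))]
    simp only [Pi.smul_apply, smul_eq_mul]
    rw [integral_const_mul, pushDensity_spec K μ φ hA', ← integral_const_mul]
    refine integral_congr_ae ?_
    filter_upwards [Lp.coeFn_smul c φ] with ω hω
    rw [hω, Pi.smul_apply, smul_eq_mul, mul_left_comm]

/-- The formal derivative of `K_{1/2}` at `μ^{1/2}`,
`φ μ^{1/2} ↦ (d{K_*(φ μ)} / d{K_* μ}) (K_* μ)^{1/2}`. -/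
noncomputable def formalDeriv (K : Kernel Ω Ω') [IsMarkovKernel K] (μ : FiniteMeasure Ω) :
    tangent μ →ₗ[ℝ] tangent (push K μ) :=
  (tangentEquiv (push K μ)).toLinearMap ∘ₗ pushDensityLinear K μ ∘ₗ
    (tangentEquiv μ).symm.toLinearMap

/-- The pullback `(K_{1/2})^* Ψ` at `μ^{1/2}` of a `2`-tensor field on `ℳ^{1/2}(Ω')`. -/
noncomputable def pullbackForm (K : Kernel Ω Ω') [IsMarkovKernel K] (Ψ : TwoTensorField Ω')
    (μ : FiniteMeasure Ω) : LinearMap.BilinForm ℝ (tangent μ) :=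
  (Ψ.form (push K μ)).compl₁₂ (formalDeriv K μ) (formalDeriv K μ)

end Markov

/-- A collection of `2`-tensor fields on `ℳ^{1/2}(Ω)`, one for each measurable space `Ω`, is a
congruent family if it is invariant under pullback by every congruent Markov kernel. -/
def IsCongruentFamily (Θ : ∀ (Ω : Type u) [MeasurableSpace Ω], TwoTensorField Ω) : Prop :=
  ∀ (Ω Ω' : Type u) [MeasurableSpace Ω] [MeasurableSpace Ω'] (K : Kernel Ω Ω') [IsMarkovKernel K],
    IsCongruent K → ∀ μ : FiniteMeasure Ω, pullbackForm K (Θ Ω') μ = (Θ Ω).form μ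

/-! ### Parametrized measure models -/

section Model

variable {Ω : Type u} [MeasurableSpace Ω]
  {E : Type v} [NormedAddCommGroup E] [NormedSpace ℝ E]
  {M : Type w} [TopologicalSpace M] [ChartedSpace E M]

/-- `(M, Ω, p)` is a parametrized measure model: `p : M → ℳ(Ω) ⊆ 𝒮(Ω)` is Fréchet differentiable
for the total variation norm on `𝒮(Ω)`. -/
def IsParametrizedMeasureModel (p : M → FiniteMeasure Ω) : Prop :=
  MDifferentiable 𝓘(ℝ, E) 𝓘(ℝ, SignedMeasure Ω)
    fun ξ => (p ξ : Measure Ω).toSignedMeasure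

/-- The model is `2`-integrable: `p^{1/2} : M → 𝒮^{1/2}(Ω)` is moreover continuously Fréchet
differentiable. -/
def IsTwoIntegrable (p : M → FiniteMeasure Ω) : Prop :=
  IsParametrizedMeasureModel (E := E) p ∧
    ContMDiff 𝓘(ℝ, E) 𝓘(ℝ, HalfDensity Ω) 1 fun ξ => sqrtMeasure (p ξ)

/-- The differential `d_ξ p (V) ∈ 𝒮(Ω)`. -/
noncomputable def dModel (p : M → FiniteMeasure Ω) (ξ : M) (V : TangentSpace 𝓘(ℝ, E) ξ) :
    SignedMeasure Ω :=
  mfderiv 𝓘(ℝ, E) 𝓘(ℝ, SignedMeasure Ω) (fun ξ => (p ξ : Measure Ω).toSignedMeasure) ξ V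

/-- The logarithmic derivative `∂_V log p(ξ) = d{d_ξ p(V)} / d{p(ξ)}`. -/
noncomputable def logDeriv (p : M → FiniteMeasure Ω) (ξ : M) (V : TangentSpace 𝓘(ℝ, E) ξ) :
    Ω → ℝ :=
  (dModel p ξ V).rnDeriv (p ξ : Measure Ω)

/-- The differential `d_ξ p^{1/2} (V) ∈ 𝒮^{1/2}(Ω)`. -/
noncomputable def dSqrtModel (p : M → FiniteMeasure Ω) (ξ : M) (V : TangentSpace 𝓘(ℝ, E) ξ) :
    HalfDensity Ω :=
  mfderiv 𝓘(ℝ, E) 𝓘(ℝ, HalfDensity Ω) (fun ξ => sqrtMeasure (p ξ)) ξ V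

/-- The total mass `‖p(ξ)‖ = p(ξ)(Ω)`. -/
noncomputable def totalMass (p : M → FiniteMeasure Ω) (ξ : M) : ℝ := (p ξ).mass

/-- The directional derivative `∂_V ‖p(ξ)‖`. -/
noncomputable def dMass (p : M → FiniteMeasure Ω) (ξ : M) (V : TangentSpace 𝓘(ℝ, E) ξ) : ℝ :=
  mfderiv 𝓘(ℝ, E) 𝓘(ℝ, ℝ) (totalMass p) ξ V

end Model

end InfoGeom

/-!
Let `f : Ω → I` be measurable with finitely many values, each of positive measure. The conditional
distributions of `μ` on the fibres of `f` form a congruent Markov kernel `I → Ω` which carries the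
law of `f` to `μ`, so on functions of `f` a congruent form at `μ` depends only on the law of `f`.
On a finite set with uniform weights, permutation invariance leaves a two-parameter family of
forms, which splitting points reduces to the two-point space; splitting also passes from uniform to
rational weights, and continuity from rational to arbitrary ones. Reading off coefficients `a`, `b`
on the two-point space and subtracting `a 𝔤_F + b τ¹ ⊗ τ¹`, we are left with a form that vanishes on
simple functions.

Continuity of a tensor concerns vector fields only and does not make the form at `μ` continuous in
its arguments. Instead, any `V` is the value at `μ` of a vector field that takes simple values at
every other measure; the form vanishes on two such fields at `t μ` for `t > 1`, and `t → 1`.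

For a model `p` and a half-density `φ κ^{1/2}` with `φ ≥ 0` vanishing where `p ξ` lives, the
function `η ↦ ⟪(p η)^{1/2}, φ κ^{1/2}⟫ ≥ 0` is minimal at `ξ`; hence the derivative of `p^{1/2}` is
orthogonal to all such half-densities, that is, tangent. Since `ν^{1/2} ↦ ν` has differential
`φ μ^{1/2} ↦ 2 φ μ`, the derivative of `p^{1/2}` in direction `V` is `½ ∂_V log p · p^{1/2}`.
-/

namespace InfoGeom

open Filter Topology
open scoped RealInnerProductSpace NNReal

section HalfDensity

variable {Ω : Type u} [MeasurableSpace Ω]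

theorem exists_forall_absolutelyContinuous {ι : Type*} [Countable ι] (m : ι → FiniteMeasure Ω) :
    ∃ κ : FiniteMeasure Ω, ∀ i, (m i : Measure Ω) ≪ (κ : Measure Ω) :=
  ⟨⟨(Measure.sum fun i => (m i : Measure Ω)).toFinite, inferInstance⟩, fun i =>
    (Measure.absolutelyContinuous_sum_right i .rfl).trans (absolutelyContinuous_toFinite _)⟩

theorem exists_absolutelyContinuous₂ (μ ν : FiniteMeasure Ω) : ∃ κ : FiniteMeasure Ω,
    (μ : Measure Ω) ≪ (κ : Measure Ω) ∧ (ν : Measure Ω) ≪ (κ : Measure Ω) :=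
  let ⟨κ, hμ, hν⟩ := exists_ge_ge (⟨μ⟩ : DomMeasure Ω) ⟨ν⟩
  ⟨κ.meas, hμ, hν⟩

theorem HalfDensity.parallelogram_law (x y : HalfDensity Ω) :
    ‖x + y‖ * ‖x + y‖ + ‖x - y‖ * ‖x - y‖ = 2 * (‖x‖ * ‖x‖ + ‖y‖ * ‖y‖) := by
  obtain ⟨μ, φ, ψ, rfl, rfl⟩ := HalfDensity.exists_ofLinear₂ x y
  simpa only [← map_add, ← map_sub, HalfDensity.norm_ofLinear, ← pow_two] using
    parallelogram_law_with_norm ℝ φ ψ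

noncomputable instance : InnerProductSpace ℝ (HalfDensity Ω) :=
  InnerProductSpace.ofNorm ℝ HalfDensity.parallelogram_law

theorem tangent_mono {μ κ : FiniteMeasure Ω} (h : (μ : Measure Ω) ≪ (κ : Measure Ω)) :
    tangent μ ≤ tangent κ := by
  rintro _ ⟨φ, rfl⟩
  exact ⟨changeBase ⟨μ⟩ ⟨κ⟩ h φ, DirectLimit.Module.of_f⟩

theorem HalfDensity.exists_mem_tangent (x : HalfDensity Ω) : ∃ μ, x ∈ tangent μ := by
  obtain ⟨μ, φ, rfl⟩ := x.exists_ofLinear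
  exact ⟨μ, φ, rfl⟩

theorem isComplete_tangent (μ : FiniteMeasure Ω) : IsComplete (tangent μ : Set (HalfDensity Ω)) :=
  (HalfDensity.of μ).isometry.isUniformInducing.isComplete_range

instance (μ : FiniteMeasure Ω) : CompleteSpace (tangent μ) :=
  (isComplete_tangent μ).completeSpace_coe

instance : CompleteSpace (HalfDensity Ω) := by
  refine Metric.complete_of_cauchySeq_tendsto fun x hx => ?_
  choose m hm using fun n => (x n).exists_mem_tangent
  obtain ⟨κ, hκ⟩ := exists_forall_absolutelyContinuous m
  obtain ⟨y, -, hy⟩ := cauchySeq_tendsto_of_isComplete (isComplete_tangent κ)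
    (fun n => tangent_mono (hκ n) (hm n)) hx
  exact ⟨y, hy⟩

open Classical in
/-- The tangent vector `φ μ^{1/2}` at `μ^{1/2}` given by a function `φ ∈ L²(μ)`; it is `0` if `φ`
is not square integrable. -/
noncomputable def mulSqrt (μ : FiniteMeasure Ω) (φ : Ω → ℝ) : tangent μ :=
  if h : MemLp φ 2 (μ : Measure Ω) then tangentEquiv μ (h.toLp φ) else 0

variable {μ κ : FiniteMeasure Ω} {φ ψ : Ω → ℝ}

theorem mulSqrt_of_memLp (h : MemLp φ 2 (μ : Measure Ω)) :
    mulSqrt μ φ = tangentEquiv μ (h.toLp φ) :=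
  dif_pos h

theorem coe_mulSqrt (h : MemLp φ 2 (μ : Measure Ω)) :
    (mulSqrt μ φ : HalfDensity Ω) = HalfDensity.of μ (h.toLp φ) := by
  rw [mulSqrt_of_memLp h]
  rfl

theorem mulSqrt_congr (h : φ =ᵐ[(μ : Measure Ω)] ψ) : mulSqrt μ φ = mulSqrt μ ψ := by
  by_cases hφ : MemLp φ 2 (μ : Measure Ω)
  · rw [mulSqrt_of_memLp hφ, mulSqrt_of_memLp (hφ.ae_eq h), (MemLp.toLp_eq_toLp_iff _ _).2 h]
  · rw [mulSqrt, mulSqrt, dif_neg hφ, dif_neg fun hψ => hφ (hψ.ae_eq h.symm)]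

@[simp]
theorem mulSqrt_coeFn (φ : Lp ℝ 2 (μ : Measure Ω)) : mulSqrt μ φ = tangentEquiv μ φ := by
  rw [mulSqrt_of_memLp (Lp.memLp φ), Lp.toLp_coeFn]

@[simp]
theorem mulSqrt_density (V : tangent μ) : mulSqrt μ (density V) = V := by
  rw [mulSqrt_coeFn, density, LinearEquiv.apply_symm_apply]

theorem density_mulSqrt (h : MemLp φ 2 (μ : Measure Ω)) :
    density (mulSqrt μ φ) =ᵐ[(μ : Measure Ω)] φ := by
  rw [mulSqrt_of_memLp h, density, LinearEquiv.symm_apply_apply]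
  exact h.coeFn_toLp

theorem mulSqrt_add (hφ : MemLp φ 2 (μ : Measure Ω)) (hψ : MemLp ψ 2 (μ : Measure Ω)) :
    mulSqrt μ (φ + ψ) = mulSqrt μ φ + mulSqrt μ ψ := by
  rw [mulSqrt_of_memLp hφ, mulSqrt_of_memLp hψ, mulSqrt_of_memLp (hφ.add hψ), MemLp.toLp_add,
    map_add]

theorem mulSqrt_smul (c : ℝ) (hφ : MemLp φ 2 (μ : Measure Ω)) :
    mulSqrt μ (c • φ) = c • mulSqrt μ φ := by
  rw [mulSqrt_of_memLp hφ, mulSqrt_of_memLp (hφ.const_smul c), MemLp.toLp_const_smul, map_smul]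

theorem mulSqrt_sub (hφ : MemLp φ 2 (μ : Measure Ω)) (hψ : MemLp ψ 2 (μ : Measure Ω)) :
    mulSqrt μ (φ - ψ) = mulSqrt μ φ - mulSqrt μ ψ := by
  rw [mulSqrt_of_memLp hφ, mulSqrt_of_memLp hψ, mulSqrt_of_memLp (hφ.sub hψ), MemLp.toLp_sub,
    map_sub]

theorem inner_mulSqrt (hφ : MemLp φ 2 (μ : Measure Ω)) (hψ : MemLp ψ 2 (μ : Measure Ω)) :
    ⟪(mulSqrt μ φ : HalfDensity Ω), mulSqrt μ ψ⟫ = ∫ ω, φ ω * ψ ω ∂(μ : Measure Ω) := by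
  rw [coe_mulSqrt hφ, coe_mulSqrt hψ, LinearIsometry.inner_map_map, L2.inner_def]
  refine integral_congr_ae ?_
  filter_upwards [hφ.coeFn_toLp, hψ.coeFn_toLp] with ω h₁ h₂
  rw [h₁, h₂, RCLike.inner_apply, conj_trivial, mul_comm]

theorem memLp_mul_rootDeriv_of_ac (h : (μ : Measure Ω) ≪ (κ : Measure Ω))
    (hφ : MemLp φ 2 (μ : Measure Ω)) :
    MemLp (fun ω => φ ω * rootDeriv (μ : Measure Ω) κ ω) 2 (κ : Measure Ω) :=
  (memLp_mul_rootDeriv h (hφ.toLp φ)).ae_eq (ae_mul_rootDeriv_congr h hφ.coeFn_toLp)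

theorem memLp_rootDeriv (h : (μ : Measure Ω) ≪ (κ : Measure Ω)) :
    MemLp (rootDeriv (μ : Measure Ω) κ) 2 (κ : Measure Ω) := by
  simpa only [one_mul] using memLp_mul_rootDeriv_of_ac h (memLp_const (1 : ℝ))

theorem coe_mulSqrt_of_ac (h : (μ : Measure Ω) ≪ (κ : Measure Ω))
    (hφ : MemLp φ 2 (μ : Measure Ω)) :
    (mulSqrt μ φ : HalfDensity Ω) = mulSqrt κ fun ω => φ ω * rootDeriv (μ : Measure Ω) κ ω := by
  have hchange : HalfDensity.of κ (changeBase ⟨μ⟩ ⟨κ⟩ h (hφ.toLp φ)) =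
      HalfDensity.of μ (hφ.toLp φ) := DirectLimit.Module.of_f
  rw [coe_mulSqrt hφ, coe_mulSqrt (memLp_mul_rootDeriv_of_ac h hφ), ← hchange]
  congr 1
  apply Lp.ext
  exact (coeFn_changeBase (μ := ⟨μ⟩) (ν := ⟨κ⟩) h _).trans <|
    (ae_mul_rootDeriv_congr h hφ.coeFn_toLp).trans (MemLp.coeFn_toLp _).symm

theorem memLp_one (μ : FiniteMeasure Ω) : MemLp (1 : Ω → ℝ) 2 (μ : Measure Ω) :=
  memLp_const 1

theorem sqrtMeasure_eq_mulSqrt (μ : FiniteMeasure Ω) :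
    sqrtMeasure μ = (mulSqrt μ 1 : HalfDensity Ω) :=
  (coe_mulSqrt (memLp_one _)).symm

theorem sqrtMeasure_eq_mulSqrt_rootDeriv (h : (μ : Measure Ω) ≪ (κ : Measure Ω)) :
    sqrtMeasure μ = (mulSqrt κ (rootDeriv (μ : Measure Ω) κ) : HalfDensity Ω) := by
  rw [sqrtMeasure_eq_mulSqrt, coe_mulSqrt_of_ac h (memLp_one _)]
  simp only [Pi.one_apply, one_mul]

theorem sqrtMeasure_eq_mulSqrt_of_withDensity (hφ : Measurable φ) (hφ0 : 0 ≤ φ)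
    (h : (μ : Measure Ω) = (κ : Measure Ω).withDensity fun ω => ENNReal.ofReal (φ ω ^ 2)) :
    sqrtMeasure μ = (mulSqrt κ φ : HalfDensity Ω) := by
  rw [sqrtMeasure_eq_mulSqrt_rootDeriv (κ := κ) (h ▸ withDensity_absolutelyContinuous _ _)]
  congr 1
  refine mulSqrt_congr ?_
  have hm : Measurable fun ω => ENNReal.ofReal (φ ω ^ 2) := by fun_prop
  filter_upwards [Measure.rnDeriv_withDensity (κ : Measure Ω) hm] with ω hω
  rw [rootDeriv, h, hω, ENNReal.toReal_ofReal (sq_nonneg _), Real.sqrt_sq (hφ0 ω)]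

theorem fisher_eq_inner (V W : tangent μ) :
    fisher μ V W = 4 * ⟪(V : HalfDensity Ω), (W : HalfDensity Ω)⟫ := by
  conv_rhs => rw [← mulSqrt_density V, ← mulSqrt_density W]
  rw [inner_mulSqrt (Lp.memLp _) (Lp.memLp _), fisher]
  norm_num

theorem tauOne_eq_inner (V : tangent μ) :
    tauOne μ V = 2 * ⟪(V : HalfDensity Ω), sqrtMeasure μ⟫ := by
  conv_rhs => rw [← mulSqrt_density V]
  rw [sqrtMeasure_eq_mulSqrt, inner_mulSqrt (Lp.memLp _) (memLp_one _), tauOne]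
  simp only [Pi.one_apply, mul_one]

theorem norm_sqrtMeasure_sq (μ : FiniteMeasure Ω) : ‖sqrtMeasure μ‖ ^ 2 = (μ.mass : ℝ) := by
  rw [← real_inner_self_eq_norm_sq, sqrtMeasure_eq_mulSqrt,
    inner_mulSqrt (memLp_one _) (memLp_one _)]
  simp only [Pi.one_apply, mul_one, integral_const, smul_eq_mul]
  rfl

theorem mulSqrt_zero_measure (φ : Ω → ℝ) : mulSqrt (0 : FiniteMeasure Ω) φ = 0 := by
  have hφ : MemLp φ 2 ((0 : FiniteMeasure Ω) : Measure Ω) := by simp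
  rw [← Submodule.coe_eq_zero, ← inner_self_eq_zero (𝕜 := ℝ), inner_mulSqrt hφ hφ]
  simp

instance : Subsingleton (tangent (0 : FiniteMeasure Ω)) :=
  subsingleton_of_forall_eq 0 fun V => by rw [← mulSqrt_density V, mulSqrt_zero_measure]

end HalfDensity

section CongruentKernel

variable {Ω Ω' : Type u} [MeasurableSpace Ω] [MeasurableSpace Ω']
  (K : Kernel Ω Ω') [IsMarkovKernel K] {κ : Ω' → Ω}

theorem mass_push (μ : FiniteMeasure Ω) : (push K μ).mass = μ.mass := by
  refine ENNReal.coe_injective ?_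
  rw [FiniteMeasure.ennreal_mass, FiniteMeasure.ennreal_mass]
  exact Measure.comp_apply_univ

theorem measurePreserving_push (hκ : Measurable κ) (hKκ : ∀ ω, (K ω).map κ = Measure.dirac ω)
    (μ : FiniteMeasure Ω) : MeasurePreserving κ (push K μ : Measure Ω') (μ : Measure Ω) := by
  have hid : K.map κ = Kernel.id := by
    ext1 ω
    rw [Kernel.map_apply _ hκ, hKκ, Kernel.id_apply]
  refine ⟨hκ, ?_⟩
  change (K ∘ₘ (μ : Measure Ω)).map κ = μ
  rw [Measure.map_comp _ _ hκ, hid, Measure.id_comp]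

theorem pushDensity_ae_eq (hκ : Measurable κ) (hKκ : ∀ ω, (K ω).map κ = Measure.dirac ω)
    (μ : FiniteMeasure Ω) (φ : Lp ℝ 2 (μ : Measure Ω)) :
    pushDensity K μ φ =ᵐ[(push K μ : Measure Ω')] φ ∘ κ := by
  have hL : MemLp (φ ∘ κ) 2 (push K μ : Measure Ω') :=
    (Lp.memLp φ).comp_measurePreserving (measurePreserving_push K hκ hKκ μ)
  have hfibre : ∀ ω, ∀ᵐ ω' ∂K ω, φ (κ ω') = φ ω := fun ω => by
    refine ae_of_ae_map hκ.aemeasurable (p := fun x => φ x = φ ω) ?_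
    rw [hKκ, ae_dirac_iff
      (measurableSet_eq_fun (Lp.stronglyMeasurable φ).measurable measurable_const)]
  rw [pushDensity_unique K μ φ (hL.toLp _) fun A' hA' => ?_]
  · exact hL.coeFn_toLp
  calc ∫ ω' in A', hL.toLp _ ω' ∂(push K μ : Measure Ω')
      = ∫ ω' in A', φ (κ ω') ∂(K ∘ₘ (μ : Measure Ω)) :=
        integral_congr_ae (ae_restrict_of_ae hL.coeFn_toLp)
    _ = ∫ ω, ∫ ω' in A', φ (κ ω') ∂K ω ∂(μ : Measure Ω) := by
        simp only [← integral_indicator hA']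
        have hint : Integrable (A'.indicator (φ ∘ κ)) (K ∘ₘ (μ : Measure Ω)) :=
          (hL.integrable one_le_two).indicator hA'
        rw [Measure.comp_eq_comp_const_apply] at hint ⊢
        exact Kernel.integral_comp hint
    _ = ∫ ω, (K ω).real A' * φ ω ∂(μ : Measure Ω) := by
        congr 1 with ω
        rw [integral_congr_ae (ae_restrict_of_ae (hfibre ω)), setIntegral_const, smul_eq_mul]

theorem formalDeriv_mulSqrt (hκ : Measurable κ) (hKκ : ∀ ω, (K ω).map κ = Measure.dirac ω)
    {μ : FiniteMeasure Ω} {φ : Ω → ℝ} (hφ : MemLp φ 2 (μ : Measure Ω)) :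
    formalDeriv K μ (mulSqrt μ φ) = mulSqrt (push K μ) (φ ∘ κ) := by
  change tangentEquiv (push K μ) (pushDensity K μ (density (mulSqrt μ φ))) = _
  rw [← mulSqrt_coeFn]
  refine mulSqrt_congr ((pushDensity_ae_eq K hκ hKκ μ _).trans ?_)
  exact (measurePreserving_push K hκ hKκ μ).quasiMeasurePreserving.ae_eq_comp (density_mulSqrt hφ)

variable {K}

theorem IsCongruent.inner_formalDeriv (hK : IsCongruent K) {μ : FiniteMeasure Ω}
    (V W : tangent μ) :
    ⟪(formalDeriv K μ V : HalfDensity Ω'), formalDeriv K μ W⟫ = ⟪(V : HalfDensity Ω), W⟫ := by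
  obtain ⟨κ, hκ, hKκ⟩ := hK
  have hmp := measurePreserving_push K hκ hKκ μ
  have hV := Lp.memLp (density V)
  have hW := Lp.memLp (density W)
  rw [← mulSqrt_density V, ← mulSqrt_density W, formalDeriv_mulSqrt K hκ hKκ hV,
    formalDeriv_mulSqrt K hκ hKκ hW, inner_mulSqrt hV hW,
    inner_mulSqrt (hV.comp_measurePreserving hmp) (hW.comp_measurePreserving hmp)]
  refine (integral_map hκ.aemeasurable (f := fun ω => density V ω * density W ω) ?_).symm.trans ?_
  · rw [hmp.map_eq]
    exact hV.aestronglyMeasurable.mul hW.aestronglyMeasurable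
  · rw [hmp.map_eq]

theorem IsCongruent.fisher_formalDeriv (hK : IsCongruent K) {μ : FiniteMeasure Ω}
    (V W : tangent μ) :
    fisher (push K μ) (formalDeriv K μ V) (formalDeriv K μ W) = fisher μ V W := by
  rw [fisher_eq_inner, fisher_eq_inner, hK.inner_formalDeriv]

theorem IsCongruent.tauOne_formalDeriv (hK : IsCongruent K) {μ : FiniteMeasure Ω}
    (V : tangent μ) : tauOne (push K μ) (formalDeriv K μ V) = tauOne μ V := by
  have hone : formalDeriv K μ (mulSqrt μ 1) = mulSqrt (push K μ) 1 := by
    obtain ⟨κ, hκ, hKκ⟩ := hK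
    exact formalDeriv_mulSqrt K hκ hKκ (memLp_one μ)
  rw [tauOne_eq_inner, tauOne_eq_inner, sqrtMeasure_eq_mulSqrt, sqrtMeasure_eq_mulSqrt, ← hone,
    hK.inner_formalDeriv]

end CongruentKernel

section CongruentForm

variable {Ω : Type u} [MeasurableSpace Ω]

/-- The filter of measures `ν` with `ν^{1/2}` close to `μ^{1/2}`. -/
noncomputable def nhdsSqrt (μ : FiniteMeasure Ω) : Filter (FiniteMeasure Ω) :=
  comap sqrtMeasure (𝓝 (sqrtMeasure μ))

theorem ContinuousOnSqrt.tendsto {Y : Type*} [TopologicalSpace Y] {F : FiniteMeasure Ω → Y}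
    (hF : ContinuousOnSqrt F) (μ : FiniteMeasure Ω) : Tendsto F (nhdsSqrt μ) (𝓝 (F μ)) := by
  let : TopologicalSpace (FiniteMeasure Ω) := .induced sqrtMeasure inferInstance
  rw [nhdsSqrt, ← nhds_induced]
  exact Continuous.tendsto hF μ

theorem tendsto_sqrtMeasure (μ : FiniteMeasure Ω) :
    Tendsto sqrtMeasure (nhdsSqrt μ) (𝓝 (sqrtMeasure μ)) :=
  tendsto_comap

theorem tendsto_mass (μ : FiniteMeasure Ω) :
    Tendsto (fun ν : FiniteMeasure Ω => (ν.mass : ℝ)) (nhdsSqrt μ) (𝓝 μ.mass) := by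
  simpa only [norm_sqrtMeasure_sq] using (tendsto_sqrtMeasure μ).norm.pow 2

theorem VectorField.tendsto (X : VectorField Ω) (μ : FiniteMeasure Ω) :
    Tendsto (fun ν => (X.toFun ν : HalfDensity Ω)) (nhdsSqrt μ) (𝓝 (X.toFun μ : HalfDensity Ω)) :=
  X.continuous_toFun.tendsto μ

/-- A choice of a bilinear form on each of the tangent cones `T_{μ^{1/2}} ℳ^{1/2}(Ω)`. -/
abbrev FormFamily : Type (u + 1) :=
  ∀ (Ω : Type u) [MeasurableSpace Ω] (μ : FiniteMeasure Ω), LinearMap.BilinForm ℝ (tangent μ)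

/-- Families of forms invariant under congruent Markov kernels and continuous on vector fields away
from the zero measure. Compared with congruent families of tensor fields, dropping continuity at
the zero measure allows multiplication by arbitrary continuous functions `(0, ∞) → ℝ` of the total
mass. -/
structure IsCongruentForm (B : FormFamily.{u}) : Prop where
  formalDeriv : ∀ {Ω Ω' : Type u} [MeasurableSpace Ω] [MeasurableSpace Ω'] (K : Kernel Ω Ω')
    [IsMarkovKernel K], IsCongruent K → ∀ (μ : FiniteMeasure Ω) (V W : tangent μ),
      B Ω' (push K μ) (InfoGeom.formalDeriv K μ V) (InfoGeom.formalDeriv K μ W) = B Ω μ V W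
  tendsto : ∀ {Ω : Type u} [MeasurableSpace Ω] (X Y : VectorField Ω) {μ : FiniteMeasure Ω},
    μ ≠ 0 → Tendsto (fun ν => B Ω ν (X.toFun ν) (Y.toFun ν)) (nhdsSqrt μ)
      (𝓝 (B Ω μ (X.toFun μ) (Y.toFun μ)))

theorem IsCongruentFamily.isCongruentForm
    {Θ : ∀ (Ω : Type u) [MeasurableSpace Ω], TwoTensorField Ω} (hΘ : IsCongruentFamily Θ) :
    IsCongruentForm fun Ω _ => (Θ Ω).form where
  formalDeriv K _ hK μ V W := by
    rw [← hΘ _ _ K hK μ]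
    rfl
  tendsto X Y μ _ := ((Θ _).continuous_form X Y).tendsto μ

namespace IsCongruentForm

variable {B C : FormFamily.{u}}

theorem sub (hB : IsCongruentForm B) (hC : IsCongruentForm C) :
    IsCongruentForm fun Ω _ μ => B Ω μ - C Ω μ where
  formalDeriv K _ hK μ V W := by
    simp only [LinearMap.sub_apply, hB.formalDeriv K hK, hC.formalDeriv K hK]
  tendsto X Y _ hμ := (hB.tendsto X Y hμ).sub (hC.tendsto X Y hμ)

theorem mass_smul {c : ℝ → ℝ} (hc : ContinuousOn c (Ioi 0)) (hB : IsCongruentForm B) :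
    IsCongruentForm fun Ω _ μ => c μ.mass • B Ω μ where
  formalDeriv K _ hK μ V W := by
    simp only [LinearMap.smul_apply, hB.formalDeriv K hK, mass_push]
  tendsto X Y μ hμ := by
    have hpos : (μ.mass : ℝ) ∈ Ioi (0 : ℝ) :=
      NNReal.coe_pos.2 (pos_iff_ne_zero.2 ((FiniteMeasure.mass_nonzero_iff μ).2 hμ))
    exact ((hc.continuousAt (Ioi_mem_nhds hpos)).tendsto.comp (tendsto_mass μ)).smul
      (hB.tendsto X Y hμ)

end IsCongruentForm

/-- The Fisher metric as a family of forms. -/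
noncomputable def fisherForm : FormFamily.{u} := fun Ω _ μ =>
  (4 : ℝ) • (innerₗ (HalfDensity Ω)).compl₁₂ (tangent μ).subtype (tangent μ).subtype

/-- The square `τ¹ ⊗ τ¹` of the canonical `1`-tensor as a family of forms. -/
noncomputable def tauForm : FormFamily.{u} := fun Ω _ μ =>
  let τ : tangent μ →ₗ[ℝ] ℝ := (2 : ℝ) • innerₗ (HalfDensity Ω) (sqrtMeasure μ) ∘ₗ
    (tangent μ).subtype
  LinearMap.BilinForm.linMulLin τ τ

theorem fisherForm_apply {μ : FiniteMeasure Ω} (V W : tangent μ) :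
    fisherForm Ω μ V W = fisher μ V W :=
  (fisher_eq_inner V W).symm

theorem tauForm_apply {μ : FiniteMeasure Ω} (V W : tangent μ) :
    tauForm Ω μ V W = tauOne μ V * tauOne μ W := by
  rw [tauOne_eq_inner, tauOne_eq_inner, real_inner_comm, real_inner_comm (sqrtMeasure μ)]
  rfl

theorem isCongruentForm_fisherForm : IsCongruentForm.{u} fisherForm where
  formalDeriv K _ hK μ V W := by
    simp only [fisherForm_apply, hK.fisher_formalDeriv]
  tendsto X Y μ _ := by
    simp only [fisherForm_apply, fisher_eq_inner]
    exact ((X.tendsto μ).inner (Y.tendsto μ)).const_mul 4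

theorem isCongruentForm_tauForm : IsCongruentForm.{u} tauForm where
  formalDeriv K _ hK μ V W := by
    simp only [tauForm_apply, hK.tauOne_formalDeriv]
  tendsto X Y μ _ := by
    simp only [tauForm_apply, tauOne_eq_inner]
    exact (((X.tendsto μ).inner (tendsto_sqrtMeasure μ)).const_mul 2).mul
      (((Y.tendsto μ).inner (tendsto_sqrtMeasure μ)).const_mul 2)

end CongruentForm

section LawDependence

variable {Ω I : Type u} [MeasurableSpace Ω] [Finite I] [MeasurableSpace I]
  [DiscreteMeasurableSpace I]

/-- The conditional distributions of `μ` on the fibres of `f`. -/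
noncomputable def fiberKernel (μ : FiniteMeasure Ω) (f : Ω → I) : Kernel I Ω :=
  Kernel.ofFunOfCountable fun i => (μ : Measure Ω)[|f ⁻¹' {i}]

variable {μ : FiniteMeasure Ω} {f : Ω → I}

theorem isMarkovKernel_fiberKernel (hμf : ∀ i, (μ : Measure Ω) (f ⁻¹' {i}) ≠ 0) :
    IsMarkovKernel (fiberKernel μ f) :=
  ⟨fun i => cond_isProbabilityMeasure (hμf i)⟩

theorem map_fiberKernel (hf : Measurable f) (hμf : ∀ i, (μ : Measure Ω) (f ⁻¹' {i}) ≠ 0) (i : I) :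
    (fiberKernel μ f i).map f = Measure.dirac i := by
  have := isMarkovKernel_fiberKernel hμf
  have hae : f =ᵐ[fiberKernel μ f i] fun _ => i :=
    ae_cond_mem (hf (measurableSet_singleton i))
  rw [Measure.map_congr hae, Measure.map_const, measure_univ, one_smul]

theorem push_fiberKernel (hf : Measurable f) [IsMarkovKernel (fiberKernel μ f)] :
    push (fiberKernel μ f) (μ.map f) = μ := by
  cases nonempty_fintype I
  refine FiniteMeasure.toMeasure_injective (Measure.ext fun s hs => ?_)
  calc (fiberKernel μ f ∘ₘ ((μ : Measure Ω).map f)) s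
      = ∑ i, fiberKernel μ f i s * (μ : Measure Ω).map f {i} := by
        rw [Measure.bind_apply hs (Kernel.aemeasurable _), lintegral_fintype]
    _ = (∑ i, (μ : Measure Ω) (f ⁻¹' {i}) • (μ : Measure Ω)[|f ⁻¹' {i}]) s := by
        simp only [Measure.coe_finsetSum, Finset.sum_apply, Measure.smul_apply, smul_eq_mul,
          Measure.map_apply hf (measurableSet_singleton _), mul_comm]
        rfl
    _ = (μ : Measure Ω) s := by rw [sum_meas_smul_cond_fiber hf]

theorem IsCongruentForm.mulSqrt_comp {B : FormFamily.{u}} (hB : IsCongruentForm B)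
    (hf : Measurable f) (hμf : ∀ i, (μ : Measure Ω) (f ⁻¹' {i}) ≠ 0) (x y : I → ℝ) :
    B Ω μ (mulSqrt μ (x ∘ f)) (mulSqrt μ (y ∘ f)) =
      B I (μ.map f) (mulSqrt _ x) (mulSqrt _ y) := by
  have := isMarkovKernel_fiberKernel hμf
  have hdirac := map_fiberKernel hf hμf
  rw [← hB.formalDeriv (fiberKernel μ f) ⟨f, hf, hdirac⟩,
    formalDeriv_mulSqrt _ hf hdirac .of_discrete,
    formalDeriv_mulSqrt _ hf hdirac .of_discrete, push_fiberKernel hf]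

end LawDependence

section VectorField

variable {Ω : Type u} [MeasurableSpace Ω]

theorem ContinuousOnSqrt.of_tendsto {Y : Type*} [TopologicalSpace Y] {F : FiniteMeasure Ω → Y}
    (hF : ∀ μ, Tendsto F (nhdsSqrt μ) (𝓝 (F μ))) : ContinuousOnSqrt F := by
  let : TopologicalSpace (FiniteMeasure Ω) := .induced sqrtMeasure inferInstance
  simp only [nhdsSqrt, ← nhds_induced] at hF
  exact continuous_iff_continuousAt.2 hF

theorem memLp_of_abs_le {μ : FiniteMeasure Ω} {φ : Ω → ℝ} {C : ℝ} (hφ : Measurable φ)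
    (hC : ∀ ω, |φ ω| ≤ C) : MemLp φ 2 (μ : Measure Ω) :=
  .of_bound hφ.aestronglyMeasurable C (.of_forall hC)

theorem norm_mulSqrt_le_mul {μ : FiniteMeasure Ω} {φ ψ : Ω → ℝ} {C : ℝ}
    (hφ : MemLp φ 2 (μ : Measure Ω)) (hψ : MemLp ψ 2 (μ : Measure Ω))
    (h : ∀ᵐ ω ∂(μ : Measure Ω), |φ ω| ≤ C * |ψ ω|) : ‖mulSqrt μ φ‖ ≤ C * ‖mulSqrt μ ψ‖ := by
  rw [Submodule.coe_norm, Submodule.coe_norm, coe_mulSqrt hφ, coe_mulSqrt hψ,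
    LinearIsometry.norm_map, LinearIsometry.norm_map]
  refine Lp.norm_le_mul_norm_of_ae_le_mul ?_
  filter_upwards [h, hφ.coeFn_toLp, hψ.coeFn_toLp] with ω hω hφω hψω
  rwa [hφω, hψω]

theorem norm_mulSqrt_sub_mulSqrt_le (μ ν : FiniteMeasure Ω) {φ : Ω → ℝ} {C : ℝ}
    (hφ : Measurable φ) (hC : ∀ ω, |φ ω| ≤ C) :
    ‖(mulSqrt μ φ - mulSqrt ν φ : HalfDensity Ω)‖ ≤ C * ‖sqrtMeasure μ - sqrtMeasure ν‖ := by
  obtain ⟨κ, hμ, hν⟩ := exists_absolutelyContinuous₂ μ ν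
  have hφμ := memLp_of_abs_le (μ := μ) hφ hC
  have hφν := memLp_of_abs_le (μ := ν) hφ hC
  have hμκ := memLp_mul_rootDeriv_of_ac hμ hφμ
  have hνκ := memLp_mul_rootDeriv_of_ac hν hφν
  rw [coe_mulSqrt_of_ac hμ hφμ, coe_mulSqrt_of_ac hν hφν, sqrtMeasure_eq_mulSqrt_rootDeriv hμ,
    sqrtMeasure_eq_mulSqrt_rootDeriv hν, ← Submodule.coe_sub, ← Submodule.coe_sub,
    ← mulSqrt_sub hμκ hνκ, ← mulSqrt_sub (memLp_rootDeriv hμ) (memLp_rootDeriv hν)]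
  refine norm_mulSqrt_le_mul (hμκ.sub hνκ) ((memLp_rootDeriv hμ).sub (memLp_rootDeriv hν))
    (.of_forall fun ω => ?_)
  simp only [Pi.sub_apply, ← mul_sub, abs_mul]
  exact mul_le_mul_of_nonneg_right (hC ω) (abs_nonneg _)

/-- The vector field `μ ↦ φ μ^{1/2}` of a bounded measurable function `φ`. -/
noncomputable def boundedField (φ : Ω → ℝ) (hφ : Measurable φ) {C : ℝ} (hC : ∀ ω, |φ ω| ≤ C) :
    VectorField Ω where
  toFun μ := mulSqrt μ φ
  continuous_toFun := .of_tendsto fun μ => by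
    refine tendsto_iff_norm_sub_tendsto_zero.2 (squeeze_zero (fun _ => norm_nonneg _)
      (fun ν => norm_mulSqrt_sub_mulSqrt_le ν μ hφ hC) ?_)
    simpa only [mul_zero] using
      (tendsto_iff_norm_sub_tendsto_zero.1 (tendsto_sqrtMeasure μ)).const_mul C

/-- The product of a continuous function and a vector field. -/
noncomputable def VectorField.smul (c : FiniteMeasure Ω → ℝ) (hc : ContinuousOnSqrt c)
    (X : VectorField Ω) : VectorField Ω where
  toFun μ := c μ • X.toFun μ
  continuous_toFun := .of_tendsto fun μ => (hc.tendsto μ).smul (X.tendsto μ)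

theorem summable_vectorField {X : ℕ → VectorField Ω} {u : ℕ → ℝ} (hu : Summable u)
    (hX : ∀ n ν, ‖(X n).toFun ν‖ ≤ u n) (ν : FiniteMeasure Ω) :
    Summable fun n => (X n).toFun ν :=
  .of_norm_bounded hu (hX · ν)

/-- The sum of a uniformly convergent series of vector fields. -/
noncomputable def VectorField.tsum (X : ℕ → VectorField Ω) {u : ℕ → ℝ} (hu : Summable u)
    (hX : ∀ n ν, ‖(X n).toFun ν‖ ≤ u n) : VectorField Ω where
  toFun ν := ∑' n, (X n).toFun ν
  continuous_toFun := by
    have hcoe : ∀ ν, ((∑' n, (X n).toFun ν : tangent ν) : HalfDensity Ω) =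
        ∑' n, ((X n).toFun ν : HalfDensity Ω) := fun ν =>
      (tangent ν).subtypeL.map_tsum (summable_vectorField hu hX ν)
    simp only [hcoe]
    let : TopologicalSpace (FiniteMeasure Ω) := .induced sqrtMeasure inferInstance
    exact continuous_tsum (fun n => (X n).continuous_toFun) hu hX

theorem exists_abs_simpleFunc_le (f : SimpleFunc Ω ℝ) : ∃ C, 1 ≤ C ∧ ∀ ω, |f ω| ≤ C := by
  obtain ⟨C, hC⟩ := f.exists_forall_norm_le
  exact ⟨max 1 C, le_max_left .., fun ω => (hC ω).trans (le_max_right ..)⟩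

theorem memLp_simpleFunc (μ : FiniteMeasure Ω) (f : SimpleFunc Ω ℝ) :
    MemLp f 2 (μ : Measure Ω) :=
  f.memLp_of_isFiniteMeasure _ _

/-- The tangent vectors `φ μ^{1/2}` with `φ` a simple function. -/
noncomputable def simpleTangent (μ : FiniteMeasure Ω) : Submodule ℝ (tangent μ) where
  carrier := {V | ∃ f : SimpleFunc Ω ℝ, V = mulSqrt μ f}
  add_mem' := by
    rintro _ _ ⟨f, rfl⟩ ⟨g, rfl⟩
    exact ⟨f + g, (mulSqrt_add (memLp_simpleFunc μ f) (memLp_simpleFunc μ g)).symm⟩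
  zero_mem' := ⟨0, by simpa using (mulSqrt_smul 0 (memLp_simpleFunc μ 0)).symm⟩
  smul_mem' := by
    rintro c _ ⟨f, rfl⟩
    exact ⟨c • f, (mulSqrt_smul c (memLp_simpleFunc μ f)).symm⟩

theorem dense_simpleTangent (μ : FiniteMeasure Ω) :
    Dense (simpleTangent μ : Set (tangent μ)) := by
  refine fun V => Metric.mem_closure_iff.2 fun ε hε => ?_
  obtain ⟨f, hf, hfL⟩ := (Lp.memLp (density V)).exists_simpleFunc_eLpNorm_sub_lt
    ENNReal.ofNat_ne_top (ENNReal.ofReal_pos.2 hε).ne'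
  refine ⟨mulSqrt μ f, ⟨f, rfl⟩, ?_⟩
  have hsub := (Lp.memLp (density V)).sub hfL
  calc dist V (mulSqrt μ f) = ‖mulSqrt μ (⇑(density V) - ⇑f)‖ := by
        rw [mulSqrt_sub (Lp.memLp _) hfL, mulSqrt_density, dist_eq_norm]
    _ = (eLpNorm (⇑(density V) - ⇑f) 2 (μ : Measure Ω)).toReal := by
        rw [Submodule.coe_norm, coe_mulSqrt hsub, LinearIsometry.norm_map, Lp.norm_toLp]
    _ < ε := ENNReal.toReal_lt_of_lt_ofReal hf

/-- A continuous function which is `1` at `μ` and vanishes at distance `1 / L` from `μ`. -/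
noncomputable def cutoff (μ : FiniteMeasure Ω) (L : ℝ) (ν : FiniteMeasure Ω) : ℝ :=
  max 0 (1 - L * ‖sqrtMeasure ν - sqrtMeasure μ‖)

theorem cutoff_self (μ : FiniteMeasure Ω) (L : ℝ) : cutoff μ L μ = 1 := by simp [cutoff]

theorem cutoff_eq_zero {μ ν : FiniteMeasure Ω} {L : ℝ}
    (h : 1 ≤ L * ‖sqrtMeasure ν - sqrtMeasure μ‖) : cutoff μ L ν = 0 :=
  max_eq_left (sub_nonpos.2 h)

theorem abs_cutoff_le_one (μ ν : FiniteMeasure Ω) {L : ℝ} (hL : 0 ≤ L) : |cutoff μ L ν| ≤ 1 := by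
  rw [cutoff, abs_of_nonneg (le_max_left ..)]
  exact max_le zero_le_one (sub_le_self _ (by positivity))

theorem continuousOnSqrt_cutoff (μ : FiniteMeasure Ω) (L : ℝ) : ContinuousOnSqrt (cutoff μ L) :=
  .of_tendsto fun ν => tendsto_const_nhds.max
    (tendsto_const_nhds.sub (((tendsto_sqrtMeasure ν).sub_const _).norm.const_mul L))

theorem norm_cutoff_smul_mulSqrt_le (μ ν : FiniteMeasure Ω) {φ : Ω → ℝ} {C s : ℝ}
    (hφ : Measurable φ) (hC : ∀ ω, |φ ω| ≤ C) (hC1 : 1 ≤ C) (hs : 0 < s) :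
    ‖cutoff μ (s * C) ν • mulSqrt ν φ‖ ≤ ‖mulSqrt μ φ‖ + s⁻¹ := by
  rcases le_or_gt 1 (s * C * ‖sqrtMeasure ν - sqrtMeasure μ‖) with hfar | hnear
  · rw [cutoff_eq_zero hfar, zero_smul, norm_zero]
    positivity
  have hclose : C * ‖sqrtMeasure ν - sqrtMeasure μ‖ ≤ s⁻¹ := by
    rw [← one_div, le_div_iff₀ hs]
    linarith
  calc ‖cutoff μ (s * C) ν • mulSqrt ν φ‖ ≤ 1 * ‖mulSqrt ν φ‖ := by
        rw [norm_smul]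
        exact mul_le_mul_of_nonneg_right (abs_cutoff_le_one μ ν (by positivity)) (norm_nonneg _)
    _ ≤ ‖mulSqrt μ φ‖ + ‖(mulSqrt ν φ - mulSqrt μ φ : HalfDensity Ω)‖ := by
        rw [one_mul]
        exact norm_le_insert' (mulSqrt ν φ : HalfDensity Ω) (mulSqrt μ φ)
    _ ≤ ‖mulSqrt μ φ‖ + s⁻¹ := by
        gcongr
        exact (norm_mulSqrt_sub_mulSqrt_le ν μ hφ hC).trans hclose

theorem finite_support_cutoff {μ ν : FiniteMeasure Ω} (hν : ν ≠ μ) {L : ℕ → ℝ}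
    (hL : Tendsto L atTop atTop) : {n | cutoff μ (L n) ν ≠ 0}.Finite := by
  have hd : 0 < ‖sqrtMeasure ν - sqrtMeasure μ‖ :=
    norm_pos_iff.2 (sub_ne_zero.2 fun h => hν (sqrtMeasure_injective h))
  have hev : ∀ᶠ n in atTop, cutoff μ (L n) ν = 0 :=
    ((hL.atTop_mul_const hd).eventually_ge_atTop 1).mono fun _ => cutoff_eq_zero
  rwa [← Nat.cofinite_eq_atTop] at hev

/-- Write `V` as a rapidly convergent sum of vectors `φₙ μ^{1/2}` with `φₙ` simple, and multiply the
field `ν ↦ φₙ ν^{1/2}` by a cutoff function whose support shrinks to `μ` as `n → ∞`. -/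
theorem exists_vectorField (μ : FiniteMeasure Ω) (V : tangent μ) :
    ∃ X : VectorField Ω, X.toFun μ = V ∧ ∀ ν, ν ≠ μ → X.toFun ν ∈ simpleTangent ν := by
  obtain ⟨v, hv, hvs, -, hvb⟩ := controlled_sum_of_mem_closure
    (s := (simpleTangent μ).toAddSubgroup) (dense_simpleTangent μ V)
    (b := fun n => (1 / 2 : ℝ) ^ n) (fun n => by positivity)
  choose g hg using hvs
  choose C hC1 hC using fun n => exists_abs_simpleFunc_le (g n)
  have hL : Tendsto (fun n => 2 ^ n * C n) atTop atTop :=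
    tendsto_atTop_mono (fun n => le_mul_of_one_le_right (by positivity) (hC1 n))
      (tendsto_pow_atTop_atTop_of_one_lt one_lt_two)
  have hv_norm : Summable fun n => ‖v n‖ :=
    (summable_nat_add_iff 1).1 <| .of_nonneg_of_le (fun _ => norm_nonneg _)
      (fun n => (hvb (n + 1) n.succ_pos).le) ((summable_nat_add_iff 1).2 summable_geometric_two)
  have hu : Summable fun n => ‖mulSqrt μ (g n)‖ + ((2 : ℝ) ^ n)⁻¹ := by
    simp only [← hg]
    exact hv_norm.add (by simpa using summable_geometric_two)
  let X : ℕ → VectorField Ω := fun n =>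
    (boundedField (g n) (g n).measurable (hC n)).smul _ (continuousOnSqrt_cutoff μ (2 ^ n * C n))
  have hX : ∀ n ν, ‖(X n).toFun ν‖ ≤ ‖mulSqrt μ (g n)‖ + ((2 : ℝ) ^ n)⁻¹ := fun n ν =>
    norm_cutoff_smul_mulSqrt_le μ ν (g n).measurable (hC n) (hC1 n) (by positivity)
  refine ⟨.tsum X hu hX, ?_, fun ν hν => ?_⟩
  · have hXμ : ∀ n, (X n).toFun μ = v n := fun n => by
      rw [hg]
      exact (congrArg (· • _) (cutoff_self μ _)).trans (one_smul ..)
    have hlim := (summable_vectorField hu hX μ).hasSum.tendsto_sum_nat.comp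
      (tendsto_add_atTop_nat 1)
    simp only [hXμ] at hlim
    have hsum : (VectorField.tsum X hu hX).toFun μ = ∑' n, v n := tsum_congr hXμ
    exact hsum.trans (tendsto_nhds_unique hlim hv)
  · have hzero : ∀ n ∉ (finite_support_cutoff hν hL).toFinset, (X n).toFun ν = 0 := fun n hn => by
      rw [Finite.mem_toFinset, mem_ofPred, not_not] at hn
      exact (congrArg (· • _) hn).trans (zero_smul ..)
    change ∑' n, (X n).toFun ν ∈ _
    rw [tsum_eq_sum hzero]
    exact sum_mem fun n _ => Submodule.smul_mem _ _ ⟨g n, rfl⟩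

end VectorField

section FiniteSpace

instance {α : Type*} [MeasurableSpace α] [DiscreteMeasurableSpace α] :
    DiscreteMeasurableSpace (ULift.{u} α) :=
  ⟨fun _ => measurableSet_preimage_up.1 (.of_discrete)⟩

variable {J : Type u} [Finite J] [MeasurableSpace J] [DiscreteMeasurableSpace J]

/-- The measure `∑ j, w j • δ_j` on a finite set. -/
noncomputable def ofWeights (w : J → ℝ≥0) : FiniteMeasure J :=
  ⟨Measure.count.withDensity fun j => (w j : ℝ≥0∞), by
    cases nonempty_fintype J
    refine isFiniteMeasure_withDensity ?_
    simp [lintegral_fintype, ENNReal.sum_eq_top]⟩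

@[simp]
theorem ofWeights_singleton (w : J → ℝ≥0) (j : J) : (ofWeights w : Measure J) {j} = w j := by
  change Measure.count.withDensity (fun j => (w j : ℝ≥0∞)) {j} = w j
  rw [withDensity_apply _ (.singleton j), lintegral_singleton, Measure.count_singleton, mul_one]

theorem ofWeights_ne_zero [Nonempty J] {w : J → ℝ≥0} (hw : ∀ j, w j ≠ 0) : ofWeights w ≠ 0 := by
  obtain ⟨j⟩ := ‹Nonempty J›
  intro h
  have hj := ofWeights_singleton w j
  simp [h, eq_comm, hw] at hj

theorem mass_ofWeights [Fintype J] (w : J → ℝ≥0) : (ofWeights w).mass = ∑ j, w j := by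
  rw [← ENNReal.coe_inj, FiniteMeasure.ennreal_mass, ← Finset.coe_univ, ← sum_measure_singleton]
  push_cast
  simp only [ofWeights_singleton]

theorem map_ofWeights_const {I : Type u} [Finite I] [MeasurableSpace I]
    [DiscreteMeasurableSpace I] (c : ℝ≥0) (f : J → I) :
    (ofWeights fun _ => c).map f = ofWeights fun i => Nat.card (f ⁻¹' {i}) * c := by
  refine FiniteMeasure.toMeasure_injective (Measure.ext_of_singleton fun i => ?_)
  cases nonempty_fintype (f ⁻¹' {i})
  rw [ofWeights_singleton, FiniteMeasure.toMeasure_map, Measure.map_apply .of_discrete .of_discrete,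
    ← coe_toFinset (f ⁻¹' {i}),
    ← sum_measure_singleton]
  simp [Set.toFinset_card]

/-- The map `x ↦ x μ^{1/2}` as a linear map, for `μ` a measure on a finite set. -/
noncomputable def mulSqrtLinear (μ : FiniteMeasure J) : (J → ℝ) →ₗ[ℝ] tangent μ where
  toFun := mulSqrt μ
  map_add' _ _ := mulSqrt_add .of_discrete .of_discrete
  map_smul' c _ := mulSqrt_smul c .of_discrete

theorem continuous_sqrtMeasure_ofWeights :
    Continuous fun w : J → ℝ≥0 => sqrtMeasure (ofWeights w) := by
  cases nonempty_fintype J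
  let κ : FiniteMeasure J := ⟨Measure.count, inferInstance⟩
  have hsqrt : ∀ w : J → ℝ≥0, sqrtMeasure (ofWeights w) =
      (tangent κ).subtype (mulSqrtLinear κ fun j => √(w j : ℝ)) := fun w => by
    refine sqrtMeasure_eq_mulSqrt_of_withDensity .of_discrete (fun _ => Real.sqrt_nonneg _) ?_
    simp only [Real.sq_sqrt (w _).coe_nonneg, ENNReal.ofReal_coe_nnreal]
    rfl
  simp only [hsqrt]
  exact ((tangent κ).subtype ∘ₗ mulSqrtLinear κ).continuous_of_finiteDimensional.comp
    (by fun_prop)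

/-- The bilinear form `B` at a measure on a finite set, in terms of densities. -/
noncomputable def coordForm (B : FormFamily.{u}) (μ : FiniteMeasure J) :
    LinearMap.BilinForm ℝ (J → ℝ) :=
  (B J μ).compl₁₂ (mulSqrtLinear μ) (mulSqrtLinear μ)

variable {B : FormFamily.{u}}

theorem IsCongruentForm.coordForm_comp (hB : IsCongruentForm B) {I : Type u} [Finite I]
    [MeasurableSpace I] [DiscreteMeasurableSpace I] {μ : FiniteMeasure J} {ν : FiniteMeasure I}
    {f : J → I} (hμν : μ.map f = ν) (hν : ∀ i, (ν : Measure I) {i} ≠ 0) (x y : I → ℝ) :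
    coordForm B μ (x ∘ f) (y ∘ f) = coordForm B ν x y := by
  subst hμν
  refine hB.mulSqrt_comp .of_discrete (fun i => ?_) x y
  rw [← Measure.map_apply .of_discrete (.singleton i)]
  exact hν i

theorem exists_forall_abs_le {α : Type*} [Finite α] (x : α → ℝ) : ∃ C, ∀ i, |x i| ≤ C :=
  let ⟨C, hC⟩ := (finite_range fun i => |x i|).bddAbove
  ⟨C, fun i => hC ⟨i, rfl⟩⟩

theorem IsCongruentForm.tendsto_coordForm (hB : IsCongruentForm B) [Nonempty J] {ι : Type*}
    {l : Filter ι} {w : ι → J → ℝ≥0} {w₀ : J → ℝ≥0} (hw : Tendsto w l (𝓝 w₀))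
    (hw₀ : ∀ j, w₀ j ≠ 0) (x y : J → ℝ) :
    Tendsto (fun i => coordForm B (ofWeights (w i)) x y) l
      (𝓝 (coordForm B (ofWeights w₀) x y)) := by
  obtain ⟨_, hx⟩ := exists_forall_abs_le x
  obtain ⟨_, hy⟩ := exists_forall_abs_le y
  exact (hB.tendsto (boundedField x .of_discrete hx) (boundedField y .of_discrete hy)
    (ofWeights_ne_zero hw₀)).comp
      (tendsto_comap_iff.2 ((continuous_sqrtMeasure_ofWeights.tendsto w₀).comp hw))

end FiniteSpace

section PermInvariant

theorem exists_eq_ite_of_perm_invariant {α R : Type*} [DecidableEq α] [Zero R] {D : α → α → R}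
    (hD : ∀ (σ : Equiv.Perm α) p q, D (σ p) (σ q) = D p q) :
    ∃ a b, ∀ p q, D p q = if p = q then a else b := by
  have hdiag : ∃ a, ∀ p, D p p = a := by
    rcases isEmpty_or_nonempty α with h | ⟨⟨o⟩⟩
    · exact ⟨0, h.elim⟩
    · exact ⟨D o o, fun p => by rw [← hD (Equiv.swap p o), Equiv.swap_apply_left]⟩
  have hoff : ∃ b, ∀ p q, p ≠ q → D p q = b := by
    by_cases h : ∃ r s : α, r ≠ s
    · obtain ⟨r, s, hrs⟩ := h
      refine ⟨D r s, fun p q hpq => ?_⟩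
      obtain ⟨σ, rfl, rfl⟩ := MulAction.is_two_pretransitive_iff.1
        (Equiv.Perm.isMultiplyPretransitive α 2) hrs hpq
      exact hD σ r s
    · exact ⟨0, fun p q hpq => (h ⟨p, q, hpq⟩).elim⟩
  obtain ⟨a, ha⟩ := hdiag
  obtain ⟨b, hb⟩ := hoff
  refine ⟨a, b, fun p q => ?_⟩
  split_ifs with h
  · rw [h, ha]
  · exact hb p q h

theorem bilinForm_eq_zero_of_perm_invariant {J T : Type*} [Finite J] [Finite T] [DecidableEq T]
    {M : LinearMap.BilinForm ℝ (J × T → ℝ)}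
    (hM : ∀ (σ : Equiv.Perm (J × T)) x y, M (x ∘ σ) (y ∘ σ) = M x y) {s t : T} (hst : s ≠ t)
    (hss : M (Pi.single s 1 ∘ Prod.snd) (Pi.single s 1 ∘ Prod.snd) = 0)
    (hst0 : M (Pi.single s 1 ∘ Prod.snd) (Pi.single t 1 ∘ Prod.snd) = 0) : M = 0 := by
  classical
  cases nonempty_fintype J
  cases nonempty_fintype T
  obtain ⟨a, b, hab⟩ := exists_eq_ite_of_perm_invariant
    (D := fun p q => M (Pi.single p 1) (Pi.single q 1)) fun σ p q => by
      have hσ : ∀ r, (Pi.single (σ r) 1 : J × T → ℝ) ∘ σ = Pi.single r 1 := fun r => by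
        ext
        simp [Pi.single_apply]
      rw [← hM σ, hσ, hσ]
  have hsum : ∀ r : T, (Pi.single r 1 ∘ Prod.snd : J × T → ℝ) = ∑ j, Pi.single (j, r) 1 :=
    fun r => by
      ext ⟨j, r'⟩
      simp [Pi.single_apply, Prod.ext_iff, ite_and]
  rcases isEmpty_or_nonempty J with hJ | hJ
  · exact LinearMap.ext fun x => by simp [Subsingleton.elim x 0]
  have hcard : (Fintype.card J : ℝ) ≠ 0 := by exact_mod_cast Fintype.card_ne_zero
  have hb : b = 0 := by simpa [hsum, hab, hst, hcard] using hst0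
  have ha : a = 0 := by simpa [hsum, hab, hb, hcard] using hss
  exact LinearMap.BilinForm.ext_basis (Pi.basisFun ℝ (J × T)) fun p q => by simp [hab, ha, hb]

end PermInvariant

section Uniqueness

/-- The two-point space. -/
abbrev TwoPoint : Type u := ULift.{u} Bool

/-- `B` vanishes on pairs of indicator functions of points for all uniform measures on the two-point
space. By symmetry it is enough to consider pairs whose first entry is the indicator function of
`false`. -/
def VanishesOnTwoPoint (B : FormFamily.{u}) : Prop :=
  ∀ c : ℝ≥0, c ≠ 0 → ∀ t : TwoPoint.{u},
    coordForm B (ofWeights fun _ : TwoPoint.{u} => c) (Pi.single ⟨false⟩ 1) (Pi.single t 1) = 0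

theorem tendsto_smul_nhdsSqrt {Ω : Type u} [MeasurableSpace Ω]
    (μ : FiniteMeasure Ω) : Tendsto (fun t : ℝ≥0 => t • μ) (𝓝 1) (nhdsSqrt μ) := by
  have hsqrt : ∀ t : ℝ≥0, sqrtMeasure (t • μ) = √(t : ℝ) • sqrtMeasure μ := fun t => by
    rw [sqrtMeasure_eq_mulSqrt_of_withDensity (κ := μ) (φ := √(t : ℝ) • 1) (by fun_prop)
      (fun _ => by simp), mulSqrt_smul _ (memLp_one μ), Submodule.coe_smul,
      ← sqrtMeasure_eq_mulSqrt]
    simp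
  refine tendsto_comap_iff.2 ?_
  simp only [Function.comp_def, hsqrt]
  exact Continuous.tendsto' (by fun_prop) _ _ (by simp)

namespace IsCongruentForm

variable {B : FormFamily.{u}} {J : Type u} [Finite J] [MeasurableSpace J]
  [DiscreteMeasurableSpace J]

theorem coordForm_perm (hB : IsCongruentForm B) {c : ℝ≥0} (hc : c ≠ 0) (σ : Equiv.Perm J)
    (x y : J → ℝ) : coordForm B (ofWeights fun _ => c) (x ∘ σ) (y ∘ σ) =
      coordForm B (ofWeights fun _ => c) x y := by
  refine hB.coordForm_comp ?_ (fun _ => by simpa using hc) x y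
  have hcard : ∀ i, Nat.card (σ ⁻¹' {i}) = 1 := fun i => by
    rw [← σ.image_symm_eq_preimage, image_singleton, Nat.card_unique]
  simp [map_ofWeights_const, hcard]

theorem coordForm_uniform_prod_eq_zero (hB : IsCongruentForm B) (h₂ : VanishesOnTwoPoint B)
    {c : ℝ≥0} (hc : c ≠ 0) : coordForm B (ofWeights fun _ : J × TwoPoint.{u} => c) = 0 := by
  classical
  cases nonempty_fintype J
  rcases isEmpty_or_nonempty J with hJ | hJ
  · exact LinearMap.ext fun x => by simp [Subsingleton.elim x 0]
  have hmap : (ofWeights fun _ : J × TwoPoint.{u} => c).map Prod.snd =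
      ofWeights fun _ : TwoPoint.{u} => Fintype.card J * c := by
    have hcard : ∀ t : TwoPoint.{u}, Nat.card (Prod.snd ⁻¹' {t} : Set (J × TwoPoint.{u})) =
        Fintype.card J := fun t => by
      simp [← univ_prod]
    simp only [map_ofWeights_const, hcard]
  have hc' : (Fintype.card J * c : ℝ≥0) ≠ 0 := by simpa using hc
  have hzero : ∀ t : TwoPoint.{u}, coordForm B (ofWeights fun _ : J × TwoPoint.{u} => c)
      (Pi.single ⟨false⟩ 1 ∘ Prod.snd) (Pi.single t 1 ∘ Prod.snd) = 0 := fun t => by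
    rw [hB.coordForm_comp hmap (fun _ => by simpa using hc), h₂ _ hc']
  exact bilinForm_eq_zero_of_perm_invariant (hB.coordForm_perm hc)
    (s := ⟨false⟩) (t := ⟨true⟩) (by simp) (hzero _) (hzero _)

theorem coordForm_natCast_mul_eq_zero (hB : IsCongruentForm B) (h₂ : VanishesOnTwoPoint B)
    {c : ℝ≥0} (hc : c ≠ 0) {k : J → ℕ} (hk : ∀ j, k j ≠ 0) :
    coordForm B (ofWeights fun j => k j * c) = 0 := by
  let : MeasurableSpace (Σ j, Fin (k j)) := ⊤
  have : DiscreteMeasurableSpace (Σ j, Fin (k j)) := ⟨fun _ => trivial⟩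
  have hmap : (ofWeights fun _ : (Σ j, Fin (k j)) × TwoPoint.{u} => c / 2).map (fun p => p.1.1) =
      ofWeights fun j => k j * c := by
    have hcard : ∀ i, Nat.card ((fun p : (Σ j, Fin (k j)) × TwoPoint.{u} => p.1.1) ⁻¹' {i}) =
        k i * 2 := fun i => by
      have hpre : ((fun p : (Σ j, Fin (k j)) × TwoPoint.{u} => p.1.1) ⁻¹' {i}) =
          range (Sigma.mk i) ×ˢ univ := by
        rw [range_sigmaMk, prod_univ]
        rfl
      rw [hpre, Nat.card_coe_set_eq, ncard_prod, ← Nat.card_coe_set_eq,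
        Nat.card_range_of_injective sigma_mk_injective]
      simp
    rw [map_ofWeights_const]
    congr 1
    ext i
    rw [hcard]
    push_cast
    ring
  refine LinearMap.ext₂ fun x y => ?_
  rw [← hB.coordForm_comp hmap (fun j => by simp [hk, hc]),
    hB.coordForm_uniform_prod_eq_zero h₂ (by simpa using hc)]
  rfl

theorem coordForm_ofWeights_eq_zero (hB : IsCongruentForm B) (h₂ : VanishesOnTwoPoint B)
    {w : J → ℝ≥0} (hw : ∀ j, w j ≠ 0) : coordForm B (ofWeights w) = 0 := by
  rcases isEmpty_or_nonempty J with hJ | hJ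
  · exact LinearMap.ext fun x => by simp [Subsingleton.elim x 0]
  have hlim : Tendsto (fun (n : ℕ) (j : J) => (⌈w j * n⌉₊ : ℝ≥0) * (n : ℝ≥0)⁻¹) atTop (𝓝 w) :=
    tendsto_pi_nhds.2 fun j => by
      rw [← NNReal.tendsto_coe]
      refine ((tendsto_nat_ceil_mul_div_atTop (w j).coe_nonneg).comp
        (tendsto_natCast_atTop_atTop (R := ℝ))).congr fun n => ?_
      have hceil : ⌈(w j : ℝ) * n⌉₊ = ⌈w j * n⌉₊ :=
        Nonneg.nat_ceil_coe (α := ℝ) (w j * (n : ℝ≥0) : ℝ≥0)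
      simp [div_eq_mul_inv, hceil]
  refine LinearMap.ext₂ fun x y => tendsto_nhds_unique (hB.tendsto_coordForm hlim hw x y)
    (tendsto_const_nhds.congr' ?_)
  filter_upwards [eventually_ne_atTop 0] with n hn
  have hn' : (n : ℝ≥0) ≠ 0 := by exact_mod_cast hn
  have hk : ∀ j, ⌈w j * n⌉₊ ≠ 0 := fun j =>
    (Nat.ceil_pos.2 (pos_iff_ne_zero.2 (mul_ne_zero (hw j) hn'))).ne'
  rw [hB.coordForm_natCast_mul_eq_zero h₂ (inv_ne_zero hn') hk]

theorem coordForm_eq_zero (hB : IsCongruentForm B) (h₂ : VanishesOnTwoPoint B)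
    {μ : FiniteMeasure J} (hμ : ∀ j, (μ : Measure J) {j} ≠ 0) : coordForm B μ = 0 := by
  have hμw : μ = ofWeights fun j => μ {j} :=
    FiniteMeasure.toMeasure_injective (Measure.ext_of_singleton fun j => by simp)
  rw [hμw]
  exact hB.coordForm_ofWeights_eq_zero h₂ fun j h => hμ j (by simpa using h)

theorem mulSqrt_comp_eq_zero (hB : IsCongruentForm B) (h₂ : VanishesOnTwoPoint B) {Ω : Type u}
    [MeasurableSpace Ω] {μ : FiniteMeasure Ω} (hμ : μ ≠ 0) {f : Ω → J} (hf : Measurable f)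
    (x y : J → ℝ) : B Ω μ (mulSqrt μ (x ∘ f)) (mulSqrt μ (y ∘ f)) = 0 := by
  let S := {j // (μ : Measure Ω) (f ⁻¹' {j}) ≠ 0}
  have hf_mem : ∀ᵐ ω ∂(μ : Measure Ω), (μ : Measure Ω) (f ⁻¹' {f ω}) ≠ 0 := by
    refine ae_of_ae_map (p := fun j => (μ : Measure Ω) (f ⁻¹' {j}) ≠ 0) hf.aemeasurable ?_
    refine (ae_iff_of_countable).2 fun j hj => ?_
    rwa [Measure.map_apply hf .of_discrete] at hj
  obtain ⟨ω₀, hω₀⟩ : ∃ ω₀, (μ : Measure Ω) (f ⁻¹' {f ω₀}) ≠ 0 := by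
    have : NeZero (μ : Measure Ω) := ⟨fun h => hμ (FiniteMeasure.toMeasure_injective h)⟩
    exact hf_mem.exists
  obtain ⟨r, hr⟩ : ∃ r : J → S, ∀ s : S, r s = s :=
    have : Nonempty S := ⟨⟨f ω₀, hω₀⟩⟩
    ⟨Function.invFun Subtype.val, Function.leftInverse_invFun Subtype.val_injective⟩
  have hrf : ∀ᵐ ω ∂(μ : Measure Ω), (r (f ω) : J) = f ω :=
    hf_mem.mono fun ω hω => congrArg Subtype.val (hr ⟨f ω, hω⟩)
  have hpull : ∀ z : J → ℝ, mulSqrt μ (z ∘ f) = mulSqrt μ ((z ∘ Subtype.val) ∘ (r ∘ f)) := fun z =>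
    mulSqrt_congr (hrf.mono fun ω hω => congrArg z hω.symm)
  have hrf_meas : Measurable (r ∘ f) := (Measurable.of_discrete (f := r)).comp hf
  have hfib : ∀ s : S, (μ : Measure Ω) ((r ∘ f) ⁻¹' {s}) ≠ 0 := fun s h =>
    s.2 (measure_mono_null (fun ω (hω : f ω = s) => by simp [hω, hr]) h)
  rw [hpull, hpull, hB.mulSqrt_comp hrf_meas hfib]
  refine LinearMap.congr_fun₂ (hB.coordForm_eq_zero h₂ fun s => ?_) _ _
  rw [FiniteMeasure.toMeasure_map, Measure.map_apply hrf_meas .of_discrete]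
  exact hfib s

theorem simpleTangent_eq_zero (hB : IsCongruentForm B) (h₂ : VanishesOnTwoPoint B) {Ω : Type u}
    [MeasurableSpace Ω] {μ : FiniteMeasure Ω} (hμ : μ ≠ 0) {V W : tangent μ}
    (hV : V ∈ simpleTangent μ) (hW : W ∈ simpleTangent μ) : B Ω μ V W = 0 := by
  obtain ⟨f, rfl⟩ := hV
  obtain ⟨g, rfl⟩ := hW
  let F : Ω → ULift.{u} (f.range × g.range) := fun ω => ⟨⟨f ω, f.mem_range_self ω⟩,
    ⟨g ω, g.mem_range_self ω⟩⟩
  have hF : Measurable F :=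
    measurable_up.comp (f.measurable.subtype_mk.prodMk g.measurable.subtype_mk)
  exact hB.mulSqrt_comp_eq_zero h₂ hμ hF (fun p => p.down.1) (fun p => p.down.2)

theorem eq_zero (hB : IsCongruentForm B) (h₂ : VanishesOnTwoPoint B) {Ω : Type u}
    [MeasurableSpace Ω] {μ : FiniteMeasure Ω} (V W : tangent μ) : B Ω μ V W = 0 := by
  rcases eq_or_ne μ 0 with rfl | hμ
  · rw [Subsingleton.elim V 0, map_zero, LinearMap.zero_apply]
  obtain ⟨X, rfl, hX⟩ := exists_vectorField μ V
  obtain ⟨Y, rfl, hY⟩ := exists_vectorField μ W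
  have hlim := (hB.tendsto X Y hμ).comp
    ((tendsto_smul_nhdsSqrt μ).mono_left (nhdsWithin_le_nhds (s := Ioi 1)))
  refine tendsto_nhds_unique hlim (tendsto_const_nhds.congr' ?_)
  filter_upwards [self_mem_nhdsWithin] with t (ht : 1 < t)
  have htμ0 : t • μ ≠ 0 := smul_ne_zero (zero_lt_one.trans ht).ne' hμ
  have htμ : t • μ ≠ μ := fun h => by
    have hmass : t * μ.mass = μ.mass :=
      (FiniteMeasure.smul_apply t μ univ).symm.trans (congrArg FiniteMeasure.mass h)
    exact ht.ne' (mul_right_cancel₀ (mt μ.mass_zero_iff.1 hμ) (hmass.trans (one_mul _).symm))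
  exact (hB.simpleTangent_eq_zero h₂ htμ0 (hX _ htμ) (hY _ htμ)).symm

end IsCongruentForm

end Uniqueness

section Classification

theorem integral_ofWeights {J : Type u} [Fintype J] [MeasurableSpace J]
    [DiscreteMeasurableSpace J] (w : J → ℝ≥0) (x : J → ℝ) :
    ∫ j, x j ∂(ofWeights w : Measure J) = ∑ j, w j * x j := by
  rw [integral_fintype .of_finite]
  simp [measureReal_def]

theorem coordForm_fisherForm {J : Type u} [Fintype J] [MeasurableSpace J]
    [DiscreteMeasurableSpace J] (w : J → ℝ≥0) (x y : J → ℝ) :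
    coordForm fisherForm (ofWeights w) x y = 4 * ∑ j, w j * (x j * y j) := by
  rw [← integral_ofWeights]
  exact congrArg (4 * ·) (inner_mulSqrt (μ := ofWeights w) .of_discrete .of_discrete)

theorem coordForm_tauForm {J : Type u} [Fintype J] [MeasurableSpace J]
    [DiscreteMeasurableSpace J] (w : J → ℝ≥0) (x y : J → ℝ) :
    coordForm tauForm (ofWeights w) x y =
      (2 * ∑ j, w j * x j) * (2 * ∑ j, w j * y j) := by
  have hτ : ∀ z : J → ℝ, tauOne (ofWeights w) (mulSqrt (ofWeights w) z) = 2 * ∑ j, w j * z j :=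
    fun z => by
      rw [← integral_ofWeights, tauOne,
        integral_congr_ae (density_mulSqrt (μ := ofWeights w) .of_discrete)]
  rw [← hτ, ← hτ, ← tauForm_apply]
  rfl

variable (B : FormFamily.{u})

/-- The value of `B` on the indicator functions of `false` and `t`, for the uniform measure of
total mass `r` on the two-point space. -/
noncomputable def twoPointValue (t : Bool) (r : ℝ) : ℝ :=
  coordForm B (ofWeights fun _ : TwoPoint.{u} => (r / 2).toNNReal)
    (Pi.single ⟨false⟩ 1) (Pi.single ⟨t⟩ 1)

/-- The coefficient of the Fisher metric in a congruent form, at total mass `r`. -/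
noncomputable def fisherCoeff (r : ℝ) : ℝ :=
  (twoPointValue B false r - twoPointValue B true r) / (2 * r)

/-- The coefficient of `τ¹ ⊗ τ¹` in a congruent form, at total mass `r`. -/
noncomputable def tauCoeff (r : ℝ) : ℝ :=
  twoPointValue B true r / r ^ 2

namespace IsCongruentForm

variable {B}

theorem continuousOn_twoPointValue (hB : IsCongruentForm B) (t : Bool) :
    ContinuousOn (twoPointValue B t) (Ioi 0) := fun r (hr : 0 < r) => by
  refine (hB.tendsto_coordForm (Continuous.tendsto ?_ r) (fun _ => ?_) _ _).mono_left inf_le_left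
  · fun_prop
  · simpa using hr

theorem continuousOn_fisherCoeff (hB : IsCongruentForm B) :
    ContinuousOn (fisherCoeff B) (Ioi 0) :=
  ((hB.continuousOn_twoPointValue false).sub (hB.continuousOn_twoPointValue true)).div
    (by fun_prop) fun _ hr => mul_ne_zero two_ne_zero (ne_of_gt hr)

theorem continuousOn_tauCoeff (hB : IsCongruentForm B) : ContinuousOn (tauCoeff B) (Ioi 0) :=
  (hB.continuousOn_twoPointValue true).div (by fun_prop) fun _ hr => pow_ne_zero 2 (ne_of_gt hr)

end IsCongruentForm

theorem vanishesOnTwoPoint_sub_smul_fisherForm_sub_smul_tauForm : VanishesOnTwoPoint fun Ω _ μ =>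
    B Ω μ - fisherCoeff B μ.mass • fisherForm Ω μ - tauCoeff B μ.mass • tauForm Ω μ := by
  rintro c hc ⟨t⟩
  have hc' : (c : ℝ) ≠ 0 := NNReal.coe_ne_zero.2 hc
  let μ := ofWeights fun _ : TwoPoint.{u} => c
  have hmass : (μ.mass : ℝ) = 2 * c := by
    rw [mass_ofWeights]
    simp
  have hvalue : ∀ s, twoPointValue B s (2 * c) =
      coordForm B μ (Pi.single ⟨false⟩ 1) (Pi.single ⟨s⟩ 1) := fun s => by
    simp [twoPointValue, μ]
  change coordForm B μ _ _ - fisherCoeff B μ.mass * coordForm fisherForm μ _ _ -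
    tauCoeff B μ.mass * coordForm tauForm μ _ _ = 0
  rw [coordForm_fisherForm, coordForm_tauForm, hmass, ← hvalue, fisherCoeff, tauCoeff]
  cases t <;> simp [Pi.single_apply] <;> field_simp <;> ring

theorem IsCongruentForm.eq_fisher_add_tauOne {B : FormFamily.{u}} (hB : IsCongruentForm B)
    {Ω : Type u} [MeasurableSpace Ω] (μ : FiniteMeasure Ω) (V W : tangent μ) :
    B Ω μ V W = fisherCoeff B μ.mass * fisher μ V W +
      tauCoeff B μ.mass * (tauOne μ V * tauOne μ W) := by
  have hzero := ((hB.sub (isCongruentForm_fisherForm.mass_smul hB.continuousOn_fisherCoeff)).sub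
    (isCongruentForm_tauForm.mass_smul hB.continuousOn_tauCoeff)).eq_zero
    (vanishesOnTwoPoint_sub_smul_fisherForm_sub_smul_tauForm B) V W
  rw [← fisherForm_apply, ← tauForm_apply]
  simp only [LinearMap.sub_apply, LinearMap.smul_apply, smul_eq_mul] at hzero
  linarith

end Classification

section SignedMeasure

variable {Ω : Type u} [MeasurableSpace Ω] {μ ν κ : FiniteMeasure Ω} {φ ψ : Ω → ℝ}

theorem norm_withDensityᵥ_le {f : Ω → ℝ} (hf : Integrable f (κ : Measure Ω)) :
    ‖(κ : Measure Ω).withDensityᵥ f‖ ≤ ∫ ω, |f ω| ∂(κ : Measure Ω) := by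
  have hle : ((κ : Measure Ω).withDensityᵥ f).variation ≤
      (κ : Measure Ω).withDensity fun ω => ‖f ω‖ₑ :=
    VectorMeasure.variation_le_of_forall_enorm_le fun A hA => by
      rw [withDensityᵥ_apply hf hA, withDensity_apply _ hA]
      exact enorm_integral_le_lintegral_enorm f
  have hint : ∫ ω, |f ω| ∂(κ : Measure Ω) = (∫⁻ ω, ‖f ω‖ₑ ∂(κ : Measure Ω)).toReal :=
    integral_norm_eq_lintegral_enorm hf.1
  rw [SignedMeasure.norm_def, SignedMeasure.totalVariation_eq_variation, hint]
  refine ENNReal.toReal_mono hf.2.ne ((hle univ).trans_eq ?_)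
  rw [withDensity_apply _ .univ, Measure.restrict_univ]

theorem norm_withDensityᵥ_mul_le (hφ : MemLp φ 2 (κ : Measure Ω)) (hψ : MemLp ψ 2 (κ : Measure Ω)) :
    ‖(κ : Measure Ω).withDensityᵥ (φ * ψ)‖ ≤ ‖mulSqrt κ φ‖ * ‖mulSqrt κ ψ‖ := by
  have hnorm : ∀ {f : Ω → ℝ}, MemLp f 2 (κ : Measure Ω) → ‖mulSqrt κ |f|‖ ≤ ‖mulSqrt κ f‖ :=
    fun hf => (norm_mulSqrt_le_mul hf.abs hf (C := 1) (by simp)).trans_eq (one_mul _)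
  calc ‖(κ : Measure Ω).withDensityᵥ (φ * ψ)‖
      ≤ ∫ ω, |φ ω| * |ψ ω| ∂(κ : Measure Ω) := by
        simpa only [Pi.mul_apply, abs_mul] using norm_withDensityᵥ_le (hφ.integrable_mul hψ)
    _ = ⟪mulSqrt κ |φ|, mulSqrt κ |ψ|⟫ := (inner_mulSqrt hφ.abs hψ.abs).symm
    _ ≤ ‖mulSqrt κ |φ|‖ * ‖mulSqrt κ |ψ|‖ := real_inner_le_norm _ _
    _ ≤ ‖mulSqrt κ φ‖ * ‖mulSqrt κ ψ‖ := by gcongr <;> exact hnorm ‹_›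

theorem withDensityᵥ_rootDeriv_sq_mul (h : (μ : Measure Ω) ≪ (κ : Measure Ω))
    (hφ : Integrable φ (μ : Measure Ω)) :
    ((κ : Measure Ω).withDensityᵥ fun ω => rootDeriv (μ : Measure Ω) κ ω ^ 2 * φ ω) =
      (μ : Measure Ω).withDensityᵥ φ := by
  rw [← withDensityᵥ_rnDeriv_smul h hφ]
  simp only [rootDeriv, Real.sq_sqrt ENNReal.toReal_nonneg, smul_eq_mul]

theorem toSignedMeasure_eq_withDensityᵥ (μ : FiniteMeasure Ω) :
    (μ : Measure Ω).toSignedMeasure = (μ : Measure Ω).withDensityᵥ 1 := by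
  ext A hA
  rw [Measure.toSignedMeasure_apply_measurable hA,
    withDensityᵥ_apply ((memLp_one μ).integrable one_le_two) hA]
  simp

theorem toSignedMeasure_eq_withDensityᵥ_rootDeriv (h : (μ : Measure Ω) ≪ (κ : Measure Ω)) :
    (μ : Measure Ω).toSignedMeasure = (κ : Measure Ω).withDensityᵥ
      (rootDeriv (μ : Measure Ω) κ * rootDeriv (μ : Measure Ω) κ) := by
  rw [toSignedMeasure_eq_withDensityᵥ,
    ← withDensityᵥ_rootDeriv_sq_mul h ((memLp_one μ).integrable one_le_two)]
  simp only [Pi.one_apply, mul_one, pow_two]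
  rfl

theorem norm_mulSqrt_one (μ : FiniteMeasure Ω) : ‖mulSqrt μ 1‖ = ‖sqrtMeasure μ‖ := by
  rw [sqrtMeasure_eq_mulSqrt, Submodule.coe_norm]

/-- The derivative `φ μ^{1/2} ↦ 2 φ μ` at `μ^{1/2}` of the map `ν^{1/2} ↦ ν`. -/
noncomputable def squareDeriv (μ : FiniteMeasure Ω) : tangent μ →L[ℝ] SignedMeasure Ω :=
  (2 : ℝ) • LinearMap.mkContinuous
    { toFun V := (μ : Measure Ω).withDensityᵥ (density V)
      map_add' V W := by
        rw [← withDensityᵥ_add ((Lp.memLp _).integrable one_le_two)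
          ((Lp.memLp _).integrable one_le_two), density, map_add]
        exact WithDensityᵥEq.congr_ae (Lp.coeFn_add _ _)
      map_smul' c V := by
        rw [RingHom.id_apply, ← withDensityᵥ_smul, density, map_smul]
        exact WithDensityᵥEq.congr_ae (Lp.coeFn_smul _ _) }
    ‖sqrtMeasure μ‖ fun V => by
      have hle := norm_withDensityᵥ_mul_le (memLp_one μ) (Lp.memLp (density V))
      rwa [one_mul, mulSqrt_density, norm_mulSqrt_one] at hle

theorem squareDeriv_apply (V : tangent μ) :
    squareDeriv μ V = (μ : Measure Ω).withDensityᵥ ((2 : ℝ) • density V : Ω → ℝ) :=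
  (withDensityᵥ_smul (density V : Ω → ℝ) 2).symm

theorem toSignedMeasure_sub_sub_squareDeriv_eq (hμ : (μ : Measure Ω) ≪ (κ : Measure Ω))
    (hν : (ν : Measure Ω) ≪ (κ : Measure Ω)) (V : tangent μ) :
    let r := rootDeriv (ν : Measure Ω) κ
    let s := rootDeriv (μ : Measure Ω) κ
    let d := fun ω => density V ω * s ω
    (ν : Measure Ω).toSignedMeasure - (μ : Measure Ω).toSignedMeasure - squareDeriv μ V =
      (κ : Measure Ω).withDensityᵥ ((r - s) * (r - s)) +
        (κ : Measure Ω).withDensityᵥ (((2 : ℝ) • s) * (r - s - d)) := by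
  intro r s d
  have hr : MemLp r 2 (κ : Measure Ω) := memLp_rootDeriv hν
  have hs : MemLp s 2 (κ : Measure Ω) := memLp_rootDeriv hμ
  have hd : MemLp d 2 (κ : Measure Ω) := memLp_mul_rootDeriv_of_ac hμ (Lp.memLp _)
  have hrr : Integrable (r * r) (κ : Measure Ω) := hr.integrable_mul hr
  have hss : Integrable (s * s) (κ : Measure Ω) := hs.integrable_mul hs
  have hsd : Integrable (((2 : ℝ) • s) * d) (κ : Measure Ω) := (hs.const_smul 2).integrable_mul hd
  have hV : squareDeriv μ V = (κ : Measure Ω).withDensityᵥ (((2 : ℝ) • s) * d) := by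
    rw [squareDeriv_apply, ← withDensityᵥ_rootDeriv_sq_mul hμ
      (((Lp.memLp (density V)).const_smul 2).integrable one_le_two)]
    congr 1
    ext ω
    simp only [Pi.smul_apply, Pi.mul_apply, smul_eq_mul, s, d]
    ring
  rw [toSignedMeasure_eq_withDensityᵥ_rootDeriv hν, toSignedMeasure_eq_withDensityᵥ_rootDeriv hμ,
    hV, ← withDensityᵥ_sub hrr hss,
    ← withDensityᵥ_sub (hrr.sub hss) hsd, ← withDensityᵥ_add
      ((hr.sub hs).integrable_mul (hr.sub hs))
      ((hs.const_smul 2).integrable_mul ((hr.sub hs).sub hd))]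
  congr 1
  ext ω
  simp only [Pi.sub_apply, Pi.add_apply, Pi.mul_apply, Pi.smul_apply, smul_eq_mul]
  ring

theorem norm_toSignedMeasure_sub_sub_squareDeriv_le (ν : FiniteMeasure Ω) (V : tangent μ) :
    ‖(ν : Measure Ω).toSignedMeasure - (μ : Measure Ω).toSignedMeasure - squareDeriv μ V‖ ≤
      ‖sqrtMeasure ν - sqrtMeasure μ‖ ^ 2 +
        2 * ‖sqrtMeasure μ‖ * ‖sqrtMeasure ν - sqrtMeasure μ - V‖ := by
  obtain ⟨κ, hμ, hν⟩ := exists_absolutelyContinuous₂ μ ν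
  let r := rootDeriv (ν : Measure Ω) κ
  let s := rootDeriv (μ : Measure Ω) κ
  let d := fun ω => density V ω * s ω
  have hr : MemLp r 2 (κ : Measure Ω) := memLp_rootDeriv hν
  have hs : MemLp s 2 (κ : Measure Ω) := memLp_rootDeriv hμ
  have hd : MemLp d 2 (κ : Measure Ω) := memLp_mul_rootDeriv_of_ac hμ (Lp.memLp _)
  have hrs : sqrtMeasure ν - sqrtMeasure μ = (mulSqrt κ (r - s) : HalfDensity Ω) := by
    rw [sqrtMeasure_eq_mulSqrt_rootDeriv hν, sqrtMeasure_eq_mulSqrt_rootDeriv hμ,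
      mulSqrt_sub hr hs, Submodule.coe_sub]
  have hV : (V : HalfDensity Ω) = mulSqrt κ d := by
    rw [← coe_mulSqrt_of_ac hμ (Lp.memLp _), mulSqrt_density]
  rw [toSignedMeasure_sub_sub_squareDeriv_eq hμ hν, hrs, hV, ← Submodule.coe_sub,
    ← mulSqrt_sub (hr.sub hs) hd, sqrtMeasure_eq_mulSqrt_rootDeriv hμ]
  simp only [← Submodule.coe_norm]
  have hsmul : ‖mulSqrt κ ((2 : ℝ) • s)‖ = 2 * ‖mulSqrt κ s‖ := by
    rw [mulSqrt_smul 2 hs, norm_smul, Real.norm_two]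
  calc _ ≤ _ := norm_add_le _ _
    _ ≤ ‖mulSqrt κ (r - s)‖ * ‖mulSqrt κ (r - s)‖ +
        ‖mulSqrt κ ((2 : ℝ) • s)‖ * ‖mulSqrt κ (r - s - d)‖ :=
      add_le_add (norm_withDensityᵥ_mul_le (hr.sub hs) (hr.sub hs))
        (norm_withDensityᵥ_mul_le (hs.const_smul 2) ((hr.sub hs).sub hd))
    _ = _ := by rw [hsmul, pow_two]

end SignedMeasure

section Derivative

variable {Ω : Type u} [MeasurableSpace Ω] {μ κ : FiniteMeasure Ω} {φ : Ω → ℝ}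
  {E : Type*} [NormedAddCommGroup E] [NormedSpace ℝ E] {f : E → FiniteMeasure Ω} {x : E}
  {L : E →L[ℝ] HalfDensity Ω}

theorem inner_sqrtMeasure_mulSqrt_nonneg (ν : FiniteMeasure Ω) (hφ : MemLp φ 2 (κ : Measure Ω))
    (h : 0 ≤ φ) : 0 ≤ ⟪sqrtMeasure ν, (mulSqrt κ φ : HalfDensity Ω)⟫ := by
  obtain ⟨ρ, hκ, hν⟩ := exists_absolutelyContinuous₂ κ ν
  rw [sqrtMeasure_eq_mulSqrt_rootDeriv hν, coe_mulSqrt_of_ac hκ hφ,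
    inner_mulSqrt (memLp_rootDeriv hν) (memLp_mul_rootDeriv_of_ac hκ hφ)]
  exact integral_nonneg fun ω =>
    mul_nonneg (Real.sqrt_nonneg _) (mul_nonneg (h ω) (Real.sqrt_nonneg _))

theorem inner_sqrtMeasure_mulSqrt_abs (hμ : (μ : Measure Ω) ≪ (κ : Measure Ω))
    (hφ : MemLp φ 2 (κ : Measure Ω)) (hφm : Measurable φ)
    (h : (mulSqrt κ φ : HalfDensity Ω) ∈ (tangent μ)ᗮ) :
    ⟪sqrtMeasure μ, (mulSqrt κ |φ| : HalfDensity Ω)⟫ = 0 := by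
  let σ : Ω → ℝ := fun ω => if 0 ≤ φ ω then 1 else -1
  have hσ : MemLp σ 2 (μ : Measure Ω) :=
    memLp_of_abs_le (C := 1)
      (.ite (measurableSet_le measurable_const hφm) measurable_const measurable_const)
      fun ω => by by_cases hω : 0 ≤ φ ω <;> simp [σ, hω]
  have habs : ∀ ω, σ ω * φ ω = |φ ω| := fun ω => by
    by_cases hω : 0 ≤ φ ω
    · simp only [σ, if_pos hω, one_mul, abs_of_nonneg hω]
    · simp only [σ, if_neg hω, neg_one_mul, abs_of_neg (not_le.1 hω)]
  rw [← h _ (mulSqrt μ σ).2, coe_mulSqrt_of_ac hμ hσ,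
    inner_mulSqrt (memLp_mul_rootDeriv_of_ac hμ hσ) hφ, sqrtMeasure_eq_mulSqrt_rootDeriv hμ,
    inner_mulSqrt (memLp_rootDeriv hμ) hφ.abs]
  refine integral_congr_ae (.of_forall fun ω => ?_)
  simp only [Pi.abs_apply, ← habs]
  ring

theorem inner_hasFDerivAt_sqrtMeasure_eq_zero (h : HasFDerivAt (fun y => sqrtMeasure (f y)) L x)
    (hφ : MemLp φ 2 (κ : Measure Ω)) (hφ0 : 0 ≤ φ)
    (hx : ⟪sqrtMeasure (f x), (mulSqrt κ φ : HalfDensity Ω)⟫ = 0) (v : E) :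
    ⟪L v, (mulSqrt κ φ : HalfDensity Ω)⟫ = 0 := by
  have hmin : IsLocalMin (fun y => ⟪sqrtMeasure (f y), (mulSqrt κ φ : HalfDensity Ω)⟫) x :=
    .of_forall fun y => hx.trans_le (inner_sqrtMeasure_mulSqrt_nonneg _ hφ hφ0)
  have hderiv := h.inner ℝ (hasFDerivAt_const (mulSqrt κ φ : HalfDensity Ω) x)
  simpa using DFunLike.congr_fun (hmin.hasFDerivAt_eq_zero hderiv) v

/-- A half-density orthogonal to `tangent (f x)` is `g κ^{1/2}` with `g` vanishing where `f x`
lives, so that `y ↦ ⟪(f y)^{1/2}, |g| κ^{1/2}⟫ ≥ 0` attains its minimum `0` at `x`. -/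
theorem mem_tangent_of_hasFDerivAt (h : HasFDerivAt (fun y => sqrtMeasure (f y)) L x) (hx : f x = μ)
    (v : E) : L v ∈ tangent μ := by
  subst hx
  rw [← (tangent (f x)).orthogonal_orthogonal, Submodule.mem_orthogonal']
  intro z hz
  obtain ⟨ρ, hρ⟩ := z.exists_mem_tangent
  obtain ⟨κ, hκ, hρκ⟩ := exists_absolutelyContinuous₂ (f x) ρ
  lift z to tangent κ using tangent_mono hρκ hρ
  obtain ⟨φ, hφm, hφ, rfl⟩ : ∃ φ, Measurable φ ∧ MemLp φ 2 (κ : Measure Ω) ∧ mulSqrt κ φ = z :=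
    ⟨density z, (Lp.stronglyMeasurable _).measurable, Lp.memLp _, mulSqrt_density z⟩
  have habs := inner_sqrtMeasure_mulSqrt_abs hκ hφ hφm hz
  have hz' : ⟪sqrtMeasure (f x), (mulSqrt κ φ : HalfDensity Ω)⟫ = 0 := by
    rw [sqrtMeasure_eq_mulSqrt]
    exact hz _ (mulSqrt _ _).2
  have hsub : (mulSqrt κ φ : HalfDensity Ω) = mulSqrt κ |φ| - mulSqrt κ (|φ| - φ) := by
    rw [mulSqrt_sub hφ.abs hφ, Submodule.coe_sub, sub_sub_cancel]
  rw [hsub, inner_sub_right,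
    inner_hasFDerivAt_sqrtMeasure_eq_zero h hφ.abs (abs_nonneg _) habs,
    inner_hasFDerivAt_sqrtMeasure_eq_zero h (hφ.abs.sub hφ) (fun ω => sub_nonneg.2 (le_abs_self _)),
    sub_zero]
  rw [mulSqrt_sub hφ.abs hφ, Submodule.coe_sub, inner_sub_right, habs, hz', sub_zero]

theorem hasFDerivAt_toSignedMeasure (h : HasFDerivAt (fun y => sqrtMeasure (f y)) L x)
    (hx : f x = μ) : HasFDerivAt (fun y => (f y : Measure Ω).toSignedMeasure)
      (squareDeriv μ ∘L L.codRestrict _ (mem_tangent_of_hasFDerivAt h hx)) x := by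
  subst hx
  have hsq : (fun y => ‖sqrtMeasure (f y) - sqrtMeasure (f x)‖ ^ 2) =o[𝓝 x] fun y => y - x :=
    (h.isBigO_sub.norm_left.norm_right.pow 2).trans_isLittleO
      (Asymptotics.isLittleO_pow_sub_sub x one_lt_two)
  have hlin := h.isLittleO.norm_left.const_mul_left (2 * ‖sqrtMeasure (f x)‖)
  refine .of_isLittleO <| (Asymptotics.IsBigO.of_norm_le fun y => ?_).trans_isLittleO
    (hsq.add hlin)
  exact norm_toSignedMeasure_sub_sub_squareDeriv_le (f y) _

end Derivative

section Chart

variable {E : Type*} [NormedAddCommGroup E] {M : Type*} [TopologicalSpace M] [ChartedSpace E M]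

theorem apply_chart_symm_chart {α : Type*} (g : M → α) (ξ : M) :
    g ((chartAt E ξ).symm (chartAt E ξ ξ)) = g ξ :=
  congrArg g ((chartAt E ξ).left_inv (mem_chart_source E ξ))

variable {F : Type*} [NormedAddCommGroup F] [NormedSpace ℝ F] {g : M → F} {ξ : M}

theorem hasMFDerivAt_iff_hasFDerivAt_chart [NormedSpace ℝ E] {g' : E →L[ℝ] F} :
    HasMFDerivAt 𝓘(ℝ, E) 𝓘(ℝ, F) g ξ g' ↔
      HasFDerivAt (g ∘ (chartAt E ξ).symm) g' (chartAt E ξ ξ) := by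
  have hcont : ContinuousAt g ξ ↔ ContinuousAt (g ∘ (chartAt E ξ).symm) (chartAt E ξ ξ) := by
    rw [(chartAt E ξ).symm.continuousAt_iff_continuousAt_comp_right (mem_chart_source E ξ),
      OpenPartialHomeomorph.symm_symm]
  have hwritten : writtenInExtChartAt 𝓘(ℝ, E) 𝓘(ℝ, F) ξ g = g ∘ (chartAt E ξ).symm := by
    ext y
    simp only [writtenInExtChartAt, mfld_simps, chartAt_self_eq]
  change ContinuousAt g ξ ∧ HasFDerivWithinAt (writtenInExtChartAt 𝓘(ℝ, E) 𝓘(ℝ, F) ξ g) g'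
    (range 𝓘(ℝ, E)) (chartAt E ξ ξ) ↔ _
  rw [hcont, hwritten, modelWithCornersSelf_coe, range_id, hasFDerivWithinAt_univ]
  exact and_iff_right_of_imp HasFDerivAt.continuousAt

end Chart

section Model

variable {Ω : Type u} [MeasurableSpace Ω] {E : Type v} [NormedAddCommGroup E] [NormedSpace ℝ E]
  {M : Type w} [TopologicalSpace M] [ChartedSpace E M] {p : M → FiniteMeasure Ω} {ξ : M}

variable (hp : MDifferentiableAt 𝓘(ℝ, E) 𝓘(ℝ, HalfDensity Ω) (fun η => sqrtMeasure (p η)) ξ)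
include hp

theorem hasFDerivAt_sqrtMeasure_chart :
    HasFDerivAt (fun y => sqrtMeasure (p ((chartAt E ξ).symm y)))
      (mfderiv 𝓘(ℝ, E) 𝓘(ℝ, HalfDensity Ω) (fun η => sqrtMeasure (p η)) ξ) (chartAt E ξ ξ) :=
  hasMFDerivAt_iff_hasFDerivAt_chart.1 hp.hasMFDerivAt

theorem dSqrtModel_mem_tangent (V : TangentSpace 𝓘(ℝ, E) ξ) : dSqrtModel p ξ V ∈ tangent (p ξ) :=
  mem_tangent_of_hasFDerivAt (hasFDerivAt_sqrtMeasure_chart hp) (apply_chart_symm_chart p ξ) V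

theorem dModel_eq_squareDeriv (V : TangentSpace 𝓘(ℝ, E) ξ) :
    dModel p ξ V = squareDeriv (p ξ) ⟨dSqrtModel p ξ V, dSqrtModel_mem_tangent hp V⟩ :=
  have h := hasFDerivAt_toSignedMeasure (hasFDerivAt_sqrtMeasure_chart hp)
    (apply_chart_symm_chart p ξ)
  DFunLike.congr_fun (hasMFDerivAt_iff_hasFDerivAt_chart
    (g := fun η => (p η : Measure Ω).toSignedMeasure) |>.2 h).mfderiv V

theorem logDeriv_ae_eq (V : TangentSpace 𝓘(ℝ, E) ξ) :
    logDeriv p ξ V =ᵐ[(p ξ : Measure Ω)]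
      (2 : ℝ) • ⇑(density ⟨dSqrtModel p ξ V, dSqrtModel_mem_tangent hp V⟩) := by
  rw [logDeriv, dModel_eq_squareDeriv hp, squareDeriv_apply]
  exact (SignedMeasure.eq_rnDeriv 0 _ (((Lp.memLp _).const_smul 2).integrable one_le_two)
    VectorMeasure.MutuallySingular.zero_left (zero_add _).symm).symm

theorem hasMFDerivAt_totalMass :
    HasMFDerivAt 𝓘(ℝ, E) 𝓘(ℝ, ℝ) (totalMass p) ξ ((2 : ℝ) • (innerSL ℝ (sqrtMeasure (p ξ))).comp
      (mfderiv 𝓘(ℝ, E) 𝓘(ℝ, HalfDensity Ω) (fun η => sqrtMeasure (p η)) ξ)) := by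
  have hmass : totalMass p = fun η => ‖sqrtMeasure (p η)‖ ^ 2 := by
    ext η
    rw [norm_sqrtMeasure_sq, totalMass]
  have hderiv := (hasFDerivAt_sqrtMeasure_chart hp).norm_sq
  rw [apply_chart_symm_chart p ξ, ← ofNat_smul_eq_nsmul ℝ] at hderiv
  rw [hmass]
  exact hasMFDerivAt_iff_hasFDerivAt_chart.2 hderiv

theorem dMass_eq_tauOne (V : TangentSpace 𝓘(ℝ, E) ξ) :
    dMass p ξ V = tauOne (p ξ) ⟨dSqrtModel p ξ V, dSqrtModel_mem_tangent hp V⟩ := by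
  rw [dMass, (hasMFDerivAt_totalMass hp).mfderiv, tauOne_eq_inner, real_inner_comm]
  rfl

theorem integrable_logDeriv_mul_logDeriv (V W : TangentSpace 𝓘(ℝ, E) ξ) :
    Integrable (fun ω => logDeriv p ξ V ω * logDeriv p ξ W ω) (p ξ : Measure Ω) :=
  (((Lp.memLp _).const_smul 2).ae_eq (logDeriv_ae_eq hp V).symm).integrable_mul
    (((Lp.memLp _).const_smul 2).ae_eq (logDeriv_ae_eq hp W).symm)

theorem integral_logDeriv_mul_logDeriv (V W : TangentSpace 𝓘(ℝ, E) ξ) :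
    ∫ ω, logDeriv p ξ V ω * logDeriv p ξ W ω ∂(p ξ : Measure Ω) =
      fisher (p ξ) ⟨dSqrtModel p ξ V, dSqrtModel_mem_tangent hp V⟩
        ⟨dSqrtModel p ξ W, dSqrtModel_mem_tangent hp W⟩ := by
  rw [fisher, ← integral_const_mul]
  refine integral_congr_ae ?_
  filter_upwards [logDeriv_ae_eq hp V, logDeriv_ae_eq hp W] with ω hV hW
  rw [hV, hW, Pi.smul_apply, Pi.smul_apply, smul_eq_mul, smul_eq_mul]
  ring

end Model

end InfoGeom

theorem mainTheorem4_general
    (Θ : ∀ (Ω : Type u) [MeasurableSpace Ω], InfoGeom.TwoTensorField Ω)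
    (hΘ : InfoGeom.IsCongruentFamily Θ) :
    ∃ a b : ℝ → ℝ, ContinuousOn a (Ioi 0) ∧ ContinuousOn b (Ioi 0) ∧
      (∀ (Ω : Type u) [MeasurableSpace Ω] (μ : FiniteMeasure Ω) (V₁ V₂ : InfoGeom.tangent μ),
        (Θ Ω).form μ V₁ V₂ = a μ.mass * InfoGeom.fisher μ V₁ V₂ +
          b μ.mass * (InfoGeom.tauOne μ V₁ * InfoGeom.tauOne μ V₂)) ∧
      (∀ (Ω : Type u) [MeasurableSpace Ω]
        (E : Type v) [NormedAddCommGroup E] [NormedSpace ℝ E]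
        (M : Type w) [TopologicalSpace M] [ChartedSpace E M]
        (p : M → FiniteMeasure Ω) (ξ : M),
        MDifferentiableAt 𝓘(ℝ, E) 𝓘(ℝ, InfoGeom.HalfDensity Ω)
          (fun η => InfoGeom.sqrtMeasure (p η)) ξ →
        ∀ V₁ V₂ : TangentSpace 𝓘(ℝ, E) ξ,
          Integrable (fun ω => InfoGeom.logDeriv p ξ V₁ ω * InfoGeom.logDeriv p ξ V₂ ω)
            (p ξ : Measure Ω) ∧
          MDifferentiableAt 𝓘(ℝ, E) 𝓘(ℝ, ℝ) (InfoGeom.totalMass p) ξ ∧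
          ∃ (h₁ : InfoGeom.dSqrtModel p ξ V₁ ∈ InfoGeom.tangent (p ξ))
            (h₂ : InfoGeom.dSqrtModel p ξ V₂ ∈ InfoGeom.tangent (p ξ)),
            (Θ Ω).form (p ξ) ⟨InfoGeom.dSqrtModel p ξ V₁, h₁⟩
                ⟨InfoGeom.dSqrtModel p ξ V₂, h₂⟩ =
              a (p ξ).mass * ∫ ω, InfoGeom.logDeriv p ξ V₁ ω * InfoGeom.logDeriv p ξ V₂ ω
                ∂(p ξ : Measure Ω) +
              b (p ξ).mass * (InfoGeom.dMass p ξ V₁ * InfoGeom.dMass p ξ V₂)) := by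
  have hB := hΘ.isCongruentForm
  refine ⟨_, _, hB.continuousOn_fisherCoeff, hB.continuousOn_tauCoeff,
    fun Ω _ μ V₁ V₂ => hB.eq_fisher_add_tauOne μ V₁ V₂, fun Ω _ E _ _ M _ _ p ξ hp V₁ V₂ =>
      ⟨InfoGeom.integrable_logDeriv_mul_logDeriv hp V₁ V₂,
        (InfoGeom.hasMFDerivAt_totalMass hp).mdifferentiableAt,
        InfoGeom.dSqrtModel_mem_tangent hp V₁, InfoGeom.dSqrtModel_mem_tangent hp V₂, ?_⟩⟩
  rw [InfoGeom.integral_logDeriv_mul_logDeriv hp, InfoGeom.dMass_eq_tauOne hp,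
    InfoGeom.dMass_eq_tauOne hp]
  exact hB.eq_fisher_add_tauOne _ _ _

theorem mainTheorem4
    (Θ : ∀ (Ω : Type u) [MeasurableSpace Ω], InfoGeom.TwoTensorField Ω)
    (hΘ : InfoGeom.IsCongruentFamily Θ) :
    ∃ a b : ℝ → ℝ, ContinuousOn a (Ioi 0) ∧ ContinuousOn b (Ioi 0) ∧
      (∀ (Ω : Type u) [MeasurableSpace Ω] (μ : FiniteMeasure Ω) (V₁ V₂ : InfoGeom.tangent μ),
        (Θ Ω).form μ V₁ V₂ = a μ.mass * InfoGeom.fisher μ V₁ V₂ +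
          b μ.mass * (InfoGeom.tauOne μ V₁ * InfoGeom.tauOne μ V₂)) ∧
      (∀ (Ω : Type u) [MeasurableSpace Ω]
        (E : Type v) [NormedAddCommGroup E] [NormedSpace ℝ E]
        (M : Type w) [TopologicalSpace M] [ChartedSpace E M] [IsManifold 𝓘(ℝ, E) 1 M]
        (p : M → FiniteMeasure Ω), InfoGeom.IsTwoIntegrable (E := E) p →
        ∀ (ξ : M) (V₁ V₂ : TangentSpace 𝓘(ℝ, E) ξ),
          Integrable (fun ω => InfoGeom.logDeriv p ξ V₁ ω * InfoGeom.logDeriv p ξ V₂ ω)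
            (p ξ : Measure Ω) ∧
          MDifferentiableAt 𝓘(ℝ, E) 𝓘(ℝ, ℝ) (InfoGeom.totalMass p) ξ ∧
          ∃ (h₁ : InfoGeom.dSqrtModel p ξ V₁ ∈ InfoGeom.tangent (p ξ))
            (h₂ : InfoGeom.dSqrtModel p ξ V₂ ∈ InfoGeom.tangent (p ξ)),
            (Θ Ω).form (p ξ) ⟨InfoGeom.dSqrtModel p ξ V₁, h₁⟩
                ⟨InfoGeom.dSqrtModel p ξ V₂, h₂⟩ =
              a (p ξ).mass * ∫ ω, InfoGeom.logDeriv p ξ V₁ ω * InfoGeom.logDeriv p ξ V₂ ω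
                ∂(p ξ : Measure Ω) +
              b (p ξ).mass * (InfoGeom.dMass p ξ V₁ * InfoGeom.dMass p ξ V₂)) := by
  obtain ⟨a, b, ha, hb, hform, hmodel⟩ := mainTheorem4_general Θ hΘ
  exact ⟨a, b, ha, hb, hform, fun Ω _ E _ _ M _ _ _ p hp ξ =>
    hmodel Ω E M p ξ (hp.2.mdifferentiable one_ne_zero ξ)⟩
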